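/- Let $1<m<2$, let $c>0$, and let $G_m(x)=c\,|x|^{m-2}$ for $x\in\mathbb{R}^2\setminus\{0\}$ (for the appropriate constant $c=c(m)$ this is the Green function of the fractional Laplacian $(-\Delta)^{m/2}$ on $\mathbb{R}^2$). Write $\nabla^\perp=(-\partial_{x_2},\partial_{x_1})$. Let $N\in\mathbb{N}$ and let $\gamma_1,\dots,\gamma_N\in\mathbb{R}$ be such that $$\sum_{j\in J}\gamma_j\neq 0\qquad\text{for every non-empty } J\subseteq\{1,\dots,N\}.$$ Then for Lebesgue-almost every $(x_1,\dots,x_N)\in(\mathbb{R}^2)^N$ the initial value problem $$\dot X_j(t)=\sum_{k\neq j}\gamma_k\,\nabla^\perp G_m\bigl(X_j(t)-X_k(t)\bigr),\qquad X_j(0)=x_j,\qquad j=1,\dots,N,$$ has a global smooth solution without collisions: there are $C^\infty$ functions $X_1,\dots,X_N:[0,\infty)\to\mathbb{R}^2$ that satisfy the system for all $t\ge 0$ (with one-sided derivatives at $t=0$) and $X_j(t)\neq X_k(t)$ for all $t\ge0$ and all $j\ne k$. -/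

import Mathlib

open scoped ContDiff

noncomputable section

namespace PointVortex

/-- The Euclidean plane. -/
abbrev Plane : Type := EuclideanSpace ℝ (Fin 2)

/-- The kernel `G_m(x) = c |x|^(m-2)`, `x ≠ 0`. For `1 < m < 2` and the appropriate positive
constant `c = c(m)` this is the Green function of `(-Δ)^(m/2)` on the plane. The (junk) value
at `x = 0` is never relevant: only collisionless configurations are considered. -/
def green (m c : ℝ) (x : Plane) : ℝ := c * ‖x‖ ^ (m - 2)

/-- The rotated gradient `∇^⊥ f = (-∂₂ f, ∂₁ f)`. -/
def perpGrad (f : Plane → ℝ) (x : Plane) : Plane :=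
  !₂[-(fderiv ℝ f x (EuclideanSpace.single 1 1)), fderiv ℝ f x (EuclideanSpace.single 0 1)]

/-- `X` is a global smooth solution, without collisions, of the point vortex system
`X_j' = ∑_{k ≠ j} γ_k ∇^⊥ G (X_j - X_k)`, `X_j(0) = x_j`, on the time interval `[0, ∞)`.
Derivatives at `t = 0` are one-sided. -/
structure IsGlobalSmoothSolution {N : ℕ} (G : Plane → ℝ) (γ : Fin N → ℝ)
    (x : Fin N → Plane) (X : Fin N → ℝ → Plane) : Prop where
  initial : ∀ j, X j 0 = x j
  noncollision : ∀ t, 0 ≤ t → ∀ j k, j ≠ k → X j t ≠ X k t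
  smooth : ∀ j, ContDiffOn ℝ ∞ (X j) (Set.Ici 0)
  motion : ∀ j, ∀ t, 0 ≤ t →
    HasDerivWithinAt (X j)
      (∑ k ∈ Finset.univ.erase j, γ k • perpGrad G (X j t - X k t)) (Set.Ici 0) t

end PointVortex

end

namespace PointVortex

/-! Collisions are excluded almost surely by averaging an energy over initial data. The unsigned
energy `lyapunov`, a sum over pairs of (|x_i - x_j|² + ε²)^((m-2)/2), is at least (2ε²)^((m-2)/2) as
soon as some pair comes within ε, and this threshold tends to infinity as ε → 0. By Markov's
inequality it suffices to bound, uniformly in ε, the integral over initial data in a ball of the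
initial energy plus its total variation along the flow on [0, T].

To have a global flow, the kernel is replaced by a smooth compactly supported one that is exact at
distances between ε and a large constant. It is still odd, orthogonal to its argument and
divergence-free. Three facts make the average finite.

(1) Rate. In the derivative of the energy of a pair, the mutual interaction of the pair drops out by
orthogonality. Only products such as |x_i - x_j|^(m-3) |x_i - x_k|^(m-3) with i, j, k distinct
remain, and these are locally integrable because 3 - m < 2; this is where m > 1 enters. The square
|x_i - x_j|^(2(m-3)) would not be integrable.

(2) Liouville. The truncated flow does not increase integrals (`lintegral_comp_flow_le`), so the
averaged rate at time s is at most the integral of the rate over the region that the flow can reach.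

(3) Confinement. That region is bounded independently of ε (`exists_displacement_bound`). This uses
the hypothesis on partial sums: a cluster of bounded diameter follows its centre of vorticity, which
only outside forces move, and a cluster of large diameter splits into smaller ones that interact
weakly. Induction on the number of vortices concludes.

Trajectories whose truncated energy stays below the threshold never meet the truncation, hence solve
the original system; they are unique and smooth, and patch over T = 1, 2, 3, .... -/

open Set Filter Topology MeasureTheory
open scoped NNReal ENNReal

/-! ### Clusters, the continuity method, and action-reaction -/

/-- A finite family of points containing two points at distance at least `(#J + 1) r` splits into
two nonempty parts at mutual distance at least `r`. -/
lemma exists_separated_partition {ι M : Type*} [DecidableEq ι] [PseudoMetricSpace M]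
    (J : Finset ι) (x : ι → M) {r : ℝ} (hr : 0 < r) {i j : ι} (hi : i ∈ J)
    (hij : (J.card + 1) * r ≤ dist (x i) (x j)) :
    ∃ I ⊆ J, i ∈ I ∧ j ∉ I ∧ ∀ k ∈ I, ∀ l ∈ J \ I, r ≤ dist (x k) (x l) := by
  set f : ι → ℕ := fun k => ⌊dist (x i) (x k) / r⌋₊ with hf
  -- Pigeonhole on shells of width r around `x i`: among `J.card + 1` shells at least one contains
  -- no point of the family. It separates the points inside it, among them i, from those outside,
  -- among them j.
  obtain ⟨l, hl, hlJ⟩ : ∃ l ∈ Finset.range (J.card + 1), l ∉ J.image f := by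
    by_contra! h
    have h1 := Finset.card_le_card (show Finset.range (J.card + 1) ⊆ J.image f from h)
    have h2 := Finset.card_image_le (s := J) (f := f)
    simp at h1
    omega
  have hne : ∀ k ∈ J, f k ≠ l := fun k hk h => hlJ (h ▸ Finset.mem_image_of_mem f hk)
  have hfi : f i = 0 := by simp [hf]
  have hl0 : 0 < l := by
    have := hne i hi
    omega
  have hfj : l < f j := by
    have : J.card + 1 ≤ f j := Nat.le_floor (by
      rw [le_div_iff₀ hr]; exact_mod_cast hij)
    have := Finset.mem_range.1 hl
    omega
  refine ⟨J.filter (fun k => f k < l), Finset.filter_subset _ _, ?_, ?_, ?_⟩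
  · simp [hi, hfi, hl0]
  · simp [hfj.le]
  · intro k hk k' hk'
    simp only [Finset.mem_sdiff, Finset.mem_filter, not_and, not_lt] at hk hk'
    have h1 : dist (x i) (x k) < l * r := by
      rw [← div_lt_iff₀ hr]
      exact (Nat.floor_lt (by positivity)).1 hk.2
    have h2 : (l + 1) * r ≤ dist (x i) (x k') := by
      rw [← le_div_iff₀ hr]
      have : l + 1 ≤ f k' := lt_of_le_of_ne (hk'.2 hk'.1) (hne k' hk'.1).symm
      have h3 := (Nat.le_floor_iff (by positivity)).1 this
      exact_mod_cast h3
    have := dist_triangle (x i) (x k) (x k')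
    linarith

/-- At the first time where φ ≤ 1, the intermediate value theorem gives φ = 1, while φ > 1 before.
The step hypothesis up to that time then forces φ ≥ 2, a contradiction. -/
lemma one_le_of_bootstrap_right {φ : ℝ → ℝ} {s t : ℝ} (hφ : ContinuousOn φ (Icc s t))
    (hs : 2 ≤ φ s)
    (hstep : ∀ b ∈ Icc s t, (∀ τ ∈ Icc s b, 1 ≤ φ τ) → ∀ τ ∈ Icc s b, 2 ≤ φ τ) :
    ∀ τ ∈ Icc s t, 1 ≤ φ τ := by
  intro τ₁ hτ₁
  by_contra! hlt
  have hsub : Icc s τ₁ ⊆ Icc s t := Icc_subset_Icc_right hτ₁.2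
  have hcomp : IsCompact (Icc s τ₁ ∩ φ ⁻¹' Iic 1) :=
    isCompact_Icc.of_isClosed_subset
      ((hφ.mono hsub).preimage_isClosed_of_isClosed isClosed_Icc isClosed_Iic) inter_subset_left
  obtain ⟨σ, ⟨hσ, hσ1⟩, hmin⟩ := hcomp.exists_isLeast ⟨τ₁, ⟨hτ₁.1, le_rfl⟩, hlt.le⟩
  have hgt : ∀ τ ∈ Ico s σ, 1 < φ τ := by
    intro τ hτ
    by_contra! h
    exact absurd (hmin ⟨⟨hτ.1, hτ.2.le.trans hσ.2⟩, h⟩) (not_le.2 hτ.2)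
  have hsubσ : Icc s σ ⊆ Icc s t := Icc_subset_Icc_right (hsub hσ).2
  obtain ⟨ρ, hρ, hρ1⟩ := intermediate_value_Icc' hσ.1 (hφ.mono hsubσ)
    (show (1 : ℝ) ∈ Icc (φ σ) (φ s) from ⟨hσ1, by linarith⟩)
  have hσ2 : 1 ≤ φ σ := by
    rcases hρ.2.lt_or_eq with h | h
    · exact absurd hρ1 (hgt ρ ⟨hρ.1, h⟩).ne'
    · rw [← h, hρ1]
  have := hstep σ (hsub hσ) (fun τ hτ => by
    rcases hτ.2.lt_or_eq with h | h
    · exact (hgt τ ⟨hτ.1, h⟩).le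
    · rwa [h]) σ ⟨hσ.1, le_rfl⟩
  have h1 : φ σ ≤ 1 := hσ1
  linarith

/-- Continuity method on an interval, started at an interior time `τ₀`. -/
lemma one_le_of_bootstrap {φ : ℝ → ℝ} {s t τ₀ : ℝ} (hφ : ContinuousOn φ (Icc s t))
    (h₀ : τ₀ ∈ Icc s t) (h2 : 2 ≤ φ τ₀)
    (hstep : ∀ a ∈ Icc s τ₀, ∀ b ∈ Icc τ₀ t,
      (∀ τ ∈ Icc a b, 1 ≤ φ τ) → ∀ τ ∈ Icc a b, 2 ≤ φ τ) :
    ∀ τ ∈ Icc s t, 1 ≤ φ τ := by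
  intro τ hτ
  rcases le_total τ₀ τ with h | h
  · exact one_le_of_bootstrap_right (hφ.mono (Icc_subset_Icc_left h₀.1)) h2
      (fun b hb => hstep τ₀ ⟨h₀.1, le_rfl⟩ b hb) τ ⟨h, hτ.2⟩
  -- Times before τ₀ are handled by reversing time.
  · have hcont : ContinuousOn (fun u => φ (-u)) (Icc (-τ₀) (-s)) := by
      refine hφ.comp continuous_neg.continuousOn ?_
      intro u hu
      exact ⟨by linarith [hu.2], by linarith [hu.1, h₀.2]⟩
    have := one_le_of_bootstrap_right hcont (by simpa using h2) (fun b hb hall u hu => by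
      refine hstep (-b) ⟨by linarith [hb.2], by linarith [hb.1]⟩ τ₀ ⟨le_rfl, h₀.2⟩ ?_ (-u)
        ⟨by linarith [hu.2], by linarith [hu.1]⟩
      intro v hv
      simpa using hall (-v) ⟨by linarith [hv.2], by linarith [hv.1]⟩) (-τ)
      ⟨by linarith, by linarith [hτ.1]⟩
    simpa using this

lemma eq_zero_of_eq_neg_self {E : Type*} [AddCommGroup E] [Module ℝ E] {v : E} (h : v = -v) :
    v = 0 := by
  have h2 : (2 : ℝ) • v = 0 := by
    rw [two_smul]
    nth_rewrite 2 [h]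
    exact add_neg_cancel v
  simpa using h2

/-- The term k = j vanishes since K 0 = 0, so the double sum may run over all pairs; swapping the
indices changes its sign. Consequently internal forces do not move the centre of vorticity of a
cluster. -/
lemma sum_smul_interaction_eq_zero {ι E : Type*} [DecidableEq ι] [AddCommGroup E] [Module ℝ E]
    (γ : ι → ℝ)
    (J : Finset ι) {K : E → E}
    (hK : ∀ u, K (-u) = -K u) (x : ι → E) :
    ∑ j ∈ J, γ j • ∑ k ∈ J.erase j, γ k • K (x j - x k) = 0 := by
  have hK0 : K 0 = 0 := eq_zero_of_eq_neg_self (by simpa using hK 0)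
  have h1 : ∀ j ∈ J, γ j • ∑ k ∈ J.erase j, γ k • K (x j - x k) =
      ∑ k ∈ J, (γ j * γ k) • K (x j - x k) := by
    intro j hj
    rw [← Finset.add_sum_erase J _ hj, Finset.smul_sum]
    simp [hK0, mul_smul]
  rw [Finset.sum_congr rfl h1]
  refine eq_zero_of_eq_neg_self ?_
  conv_rhs => rw [Finset.sum_comm, ← Finset.sum_neg_distrib]
  refine Finset.sum_congr rfl fun j _ => ?_
  rw [← Finset.sum_neg_distrib]
  refine Finset.sum_congr rfl fun k _ => ?_
  rw [← neg_sub (x j) (x k), hK, smul_neg, neg_neg, mul_comm]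

/-! ### Displacement bound independent of the singularity of the kernel -/

section Displacement

variable {ι E : Type*} [Fintype ι] [DecidableEq ι] [NormedAddCommGroup E] [NormedSpace ℝ E]

/-- If no two vortices of the cluster `J` are farther apart than `ρ`, the motion of each of them is
controlled by the motion of the centre of vorticity. -/
lemma dist_le_of_diam_le {γ : ι → ℝ} {B ρ : ℝ} (hB : 0 ≤ B) {J : Finset ι}
    (hJ : ∑ j ∈ J, γ j ≠ 0) {K : E → E} (hK : ∀ u, K (-u) = -K u) {X X' : ι → ℝ → E} {s t : ℝ}
    (hX : ∀ j ∈ J, ∀ τ ∈ Icc s t, HasDerivWithinAt (X j) (X' j τ) (Icc s t) τ)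
    (hX' : ∀ j ∈ J, ∀ τ ∈ Icc s t,
      ‖X' j τ - ∑ k ∈ J.erase j, γ k • K (X j τ - X k τ)‖ ≤ B)
    (hρ : ∀ τ ∈ Icc s t, ∀ i ∈ J, ∀ j ∈ J, dist (X i τ) (X j τ) ≤ ρ)
    {i : ι} (hi : i ∈ J) {τ τ' : ℝ} (hτ : τ ∈ Icc s t) (hτ' : τ' ∈ Icc s t) :
    dist (X i τ) (X i τ') ≤
      ((∑ j, |γ j|) * B * (t - s) + 2 * (∑ j, |γ j|) * ρ) * |∑ j ∈ J, γ j|⁻¹ := by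
  set Γ := ∑ j, |γ j|
  have hΓ : ∑ j ∈ J, |γ j| ≤ Γ :=
    Finset.sum_le_sum_of_subset_of_nonneg (Finset.subset_univ _) fun _ _ _ => abs_nonneg _
  have hΓ0 : 0 ≤ Γ := Finset.sum_nonneg fun _ _ => abs_nonneg _
  have hρ0 : 0 ≤ ρ := dist_nonneg.trans (hρ τ hτ i hi i hi)
  have hM : ∀ u ∈ Icc s t, HasDerivWithinAt (fun u => ∑ j ∈ J, γ j • X j u)
      (∑ j ∈ J, γ j • X' j u) (Icc s t) u := fun u hu =>
    HasDerivWithinAt.fun_sum fun j hj => (hX j hj u hu).const_smul (γ j)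
  have hM' : ∀ u ∈ Icc s t, ‖∑ j ∈ J, γ j • X' j u‖ ≤ Γ * B := by
    intro u hu
    have : ∑ j ∈ J, γ j • X' j u =
        ∑ j ∈ J, γ j • (X' j u - ∑ k ∈ J.erase j, γ k • K (X j u - X k u)) := by
      simp only [smul_sub, Finset.sum_sub_distrib,
        sum_smul_interaction_eq_zero γ J hK (fun j => X j u), sub_zero]
    rw [this]
    calc _ ≤ ∑ j ∈ J, |γ j| * B := norm_sum_le_of_le _ fun j hj => by
          rw [norm_smul, Real.norm_eq_abs]
          exact mul_le_mul_of_nonneg_left (hX' j hj u hu) (abs_nonneg _)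
      _ = (∑ j ∈ J, |γ j|) * B := by rw [Finset.sum_mul]
      _ ≤ Γ * B := by gcongr
  have hMM : ‖∑ j ∈ J, γ j • X j τ - ∑ j ∈ J, γ j • X j τ'‖ ≤ Γ * B * (t - s) := by
    refine ((convex_Icc s t).norm_image_sub_le_of_norm_hasDerivWithin_le hM hM' hτ' hτ).trans ?_
    have : ‖τ - τ'‖ ≤ t - s := by
      rw [Real.norm_eq_abs, abs_le]
      exact ⟨by linarith [hτ.1, hτ'.2], by linarith [hτ.2, hτ'.1]⟩
    gcongr
  have hdev : ∀ u ∈ Icc s t, ‖∑ j ∈ J, γ j • (X i u - X j u)‖ ≤ Γ * ρ := by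
    intro u hu
    calc _ ≤ ∑ j ∈ J, |γ j| * ρ := norm_sum_le_of_le _ fun j hj => by
          rw [norm_smul, Real.norm_eq_abs, ← dist_eq_norm]
          exact mul_le_mul_of_nonneg_left (hρ u hu i hi j hj) (abs_nonneg _)
      _ = (∑ j ∈ J, |γ j|) * ρ := by rw [Finset.sum_mul]
      _ ≤ Γ * ρ := by gcongr
  -- Each vortex is expressed through the centre of vorticity and its offsets from the other
  -- vortices; the total vorticity is then divided out, which is where its nonvanishing enters.
  have key : (∑ j ∈ J, γ j) • (X i τ - X i τ') =
      (∑ j ∈ J, γ j • X j τ - ∑ j ∈ J, γ j • X j τ') +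
        ∑ j ∈ J, γ j • (X i τ - X j τ) - ∑ j ∈ J, γ j • (X i τ' - X j τ') := by
    simp only [smul_sub, Finset.sum_sub_distrib, Finset.sum_smul]
    abel
  have hn : |∑ j ∈ J, γ j| * dist (X i τ) (X i τ') ≤ Γ * B * (t - s) + 2 * Γ * ρ := by
    rw [dist_eq_norm, ← Real.norm_eq_abs, ← norm_smul, key]
    refine (norm_sub_le _ _).trans ?_
    have h1 := norm_add_le (∑ j ∈ J, γ j • X j τ - ∑ j ∈ J, γ j • X j τ')
      (∑ j ∈ J, γ j • (X i τ - X j τ))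
    linarith [hdev τ hτ, hdev τ' hτ']
  rw [← div_eq_mul_inv, le_div_iff₀ (abs_pos.2 hJ)]
  linarith

/-- Uniform bound for the displacement of vortices moving under an odd interaction kernel `K` that
is bounded by `b` outside the unit ball, and an external field bounded by `B`. The bound depends on
the kernel only through `b`. -/
theorem exists_displacement_bound (γ : ι → ℝ)
    (hγ : ∀ J : Finset ι, J.Nonempty → ∑ j ∈ J, γ j ≠ 0) {b T : ℝ} (hb : 0 ≤ b) (hT : 0 ≤ T)
    (n : ℕ) : ∀ B : ℝ, 0 ≤ B → ∃ D : ℝ, 0 ≤ D ∧ ∀ J : Finset ι, J.card ≤ n →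
      ∀ K : E → E, (∀ u, K (-u) = -K u) → (∀ u, 1 ≤ ‖u‖ → ‖K u‖ ≤ b) →
      ∀ (X X' : ι → ℝ → E) (s t : ℝ), t - s ≤ T →
      (∀ j ∈ J, ∀ τ ∈ Icc s t, HasDerivWithinAt (X j) (X' j τ) (Icc s t) τ) →
      (∀ j ∈ J, ∀ τ ∈ Icc s t,
        ‖X' j τ - ∑ k ∈ J.erase j, γ k • K (X j τ - X k τ)‖ ≤ B) →
      ∀ j ∈ J, ∀ τ ∈ Icc s t, ∀ τ' ∈ Icc s t, dist (X j τ) (X j τ') ≤ D := by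
  induction n with
  | zero =>
    intro B _
    refine ⟨0, le_rfl, fun J hJ => ?_⟩
    have : J = ∅ := by simpa using hJ
    subst this
    simp
  | succ n ih =>
    intro B hB
    set Γ := ∑ j, |γ j|
    have hΓ0 : 0 ≤ Γ := Finset.sum_nonneg fun _ _ => abs_nonneg _
    -- For a subcluster, vortices at distance at least 1 count as external field and add at most Γ
    -- b.
    obtain ⟨D', hD', hD⟩ := ih (B + Γ * b) (by positivity)
    -- Two points separated by r at time τ₀, each moving by at most D', stay at distance at least 2,
    -- which closes the bootstrap. The threshold ρ is what the partition lemma needs for up to n + 1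
    -- points.
    set r := 2 + 2 * D'
    set ρ := (n + 2) * r
    have hr : 0 < r := by positivity
    -- D' serves the case where the cluster splits, the second summand the case of diameter at most
    -- ρ. Summing the inverses over all subsets makes the bound uniform in J.
    refine ⟨D' + (Γ * B * T + 2 * Γ * ρ) * ∑ J : Finset ι, |∑ j ∈ J, γ j|⁻¹, by positivity, ?_⟩
    intro J hJc K hK hKb X X' s t hst hX hX'
    by_cases hdiam : ∀ τ ∈ Icc s t, ∀ i ∈ J, ∀ j ∈ J, dist (X i τ) (X j τ) ≤ ρ
    · intro i hi τ hτ τ' hτ'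
      refine (dist_le_of_diam_le hB (hγ J ⟨i, hi⟩) hK hX hX' hdiam hi hτ hτ').trans ?_
      have h1 : |∑ j ∈ J, γ j|⁻¹ ≤ ∑ J : Finset ι, |∑ j ∈ J, γ j|⁻¹ :=
        Finset.single_le_sum (f := fun J : Finset ι => |∑ j ∈ J, γ j|⁻¹)
          (fun _ _ => by positivity) (Finset.mem_univ J)
      calc _ ≤ (Γ * B * T + 2 * Γ * ρ) * ∑ J : Finset ι, |∑ j ∈ J, γ j|⁻¹ := by gcongr
        _ ≤ _ := le_add_of_nonneg_left hD'
    push Not at hdiam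
    obtain ⟨τ₀, hτ₀, i, hi, j, hj, hij⟩ := hdiam
    have hle : ((J.card : ℝ) + 1) * r ≤ dist (X i τ₀) (X j τ₀) := by
      refine le_trans ?_ hij.le
      have : (J.card : ℝ) ≤ n + 1 := by exact_mod_cast hJc
      exact mul_le_mul_of_nonneg_right (by linarith) hr.le
    obtain ⟨I, hIJ, hiI, hjI, hsep⟩ :=
      exists_separated_partition J (fun k => X k τ₀) hr hi hle
    have hcard : I.card ≤ n := by
      have : I ⊂ J := hIJ.ssubset_of_ne (fun h => hjI (h ▸ hj))
      have := Finset.card_lt_card this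
      omega
    have hcard' : (J \ I).card ≤ n := by
      have : J \ I ⊂ J := Finset.sdiff_subset.ssubset_of_ne
        (fun h => (Finset.mem_sdiff.1 (h.symm ▸ hi : i ∈ J \ I)).2 hiI)
      have := Finset.card_lt_card this
      omega
    have hsub : ∀ s' t', s ≤ s' → t' ≤ t → Icc s' t' ⊆ Icc s t := fun _ _ h h' =>
      Icc_subset_Icc h h'
    -- a subcluster that stays away from the rest moves little
    have hcluster : ∀ s' t', s ≤ s' → t' ≤ t → ∀ I' ⊆ J, I'.card ≤ n →
        (∀ τ ∈ Icc s' t', ∀ k ∈ I', ∀ l ∈ J \ I', 1 ≤ dist (X k τ) (X l τ)) →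
        ∀ k ∈ I', ∀ τ ∈ Icc s' t', ∀ τ' ∈ Icc s' t', dist (X k τ) (X k τ') ≤ D' := by
      intro s' t' hs' ht' I' hI' hI'c hfar
      refine hD I' hI'c K hK hKb X X' s' t' (by linarith)
        (fun k hk τ hτ => (hX k (hI' hk) τ (hsub _ _ hs' ht' hτ)).mono (hsub _ _ hs' ht')) ?_
      intro k hk τ hτ
      have hdecomp : ∑ l ∈ J.erase k, γ l • K (X k τ - X l τ) =
          ∑ l ∈ I'.erase k, γ l • K (X k τ - X l τ) +
          ∑ l ∈ J \ I', γ l • K (X k τ - X l τ) := by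
        rw [← Finset.sum_union]
        · congr 1
          ext l
          simp only [Finset.mem_erase, Finset.mem_union, Finset.mem_sdiff]
          constructor
          · rintro ⟨h1, h2⟩
            by_cases h : l ∈ I' <;> simp [*]
          · rintro (⟨h1, h2⟩ | ⟨h1, h2⟩)
            · exact ⟨h1, hI' h2⟩
            · exact ⟨fun h => h2 (h ▸ hk), h1⟩
        · refine Finset.disjoint_left.2 fun l hl hl' => ?_
          exact (Finset.mem_sdiff.1 hl').2 (Finset.mem_of_mem_erase hl)
      have hext : ‖∑ l ∈ J \ I', γ l • K (X k τ - X l τ)‖ ≤ Γ * b := by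
        calc _ ≤ ∑ l ∈ J \ I', |γ l| * b := norm_sum_le_of_le _ fun l hl => by
              rw [norm_smul, Real.norm_eq_abs]
              refine mul_le_mul_of_nonneg_left (hKb _ ?_) (abs_nonneg _)
              rw [← dist_eq_norm]
              exact hfar τ hτ k hk l hl
          _ = (∑ l ∈ J \ I', |γ l|) * b := by rw [Finset.sum_mul]
          _ ≤ Γ * b := by
            gcongr
            exact Finset.sum_le_sum_of_subset_of_nonneg (Finset.subset_univ _)
              fun _ _ _ => abs_nonneg _
      have h1 := hX' k (hI' hk) τ (hsub _ _ hs' ht' hτ)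
      rw [hdecomp] at h1
      calc _ = ‖(X' k τ - (∑ l ∈ I'.erase k, γ l • K (X k τ - X l τ) +
              ∑ l ∈ J \ I', γ l • K (X k τ - X l τ))) +
              ∑ l ∈ J \ I', γ l • K (X k τ - X l τ)‖ := by congr 1; abel
        _ ≤ _ := (norm_add_le _ _).trans (add_le_add h1 hext)
    have hboth : ∀ s' t', s ≤ s' → t' ≤ t →
        (∀ τ ∈ Icc s' t', ∀ k ∈ I, ∀ l ∈ J \ I, 1 ≤ dist (X k τ) (X l τ)) →
        ∀ k ∈ J, ∀ τ ∈ Icc s' t', ∀ τ' ∈ Icc s' t', dist (X k τ) (X k τ') ≤ D' := by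
      intro s' t' hs' ht' hfar k hk
      by_cases hkI : k ∈ I
      · exact hcluster s' t' hs' ht' I hIJ hcard hfar k hkI
      · refine hcluster s' t' hs' ht' (J \ I) Finset.sdiff_subset hcard' ?_ k
          (Finset.mem_sdiff.2 ⟨hk, hkI⟩)
        intro τ hτ k hk l hl
        rw [Finset.sdiff_sdiff_eq_self hIJ] at hl
        rw [dist_comm]
        exact hfar τ hτ l hl k hk
    have hne : (I ×ˢ (J \ I)).Nonempty := ⟨(i, j), by simp [hiI, hj, hjI]⟩
    set φ : ℝ → ℝ := fun τ => (I ×ˢ (J \ I)).inf' hne (fun p => dist (X p.1 τ) (X p.2 τ)) with hφ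
    have hφle : ∀ c τ, c ≤ φ τ ↔ ∀ k ∈ I, ∀ l ∈ J \ I, c ≤ dist (X k τ) (X l τ) := by
      intro c τ
      simp only [hφ, Finset.le_inf'_iff, Finset.mem_product, Prod.forall, and_imp]
      exact ⟨fun h k hk l hl => h k l hk hl, fun h k l hk hl => h k hk l hl⟩
    have hφc : ContinuousOn φ (Icc s t) := by
      refine ContinuousOn.finset_inf'_apply hne fun p hp => ?_
      have hp' := Finset.mem_product.1 hp
      exact continuous_dist.comp_continuousOn <| ContinuousOn.prodMk
        (HasDerivWithinAt.continuousOn (hX p.1 (hIJ hp'.1)))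
        (HasDerivWithinAt.continuousOn (hX p.2 (Finset.mem_sdiff.1 hp'.2).1))
    have hfar : ∀ τ ∈ Icc s t, 1 ≤ φ τ := by
      refine one_le_of_bootstrap hφc hτ₀ ?_ ?_
      · rw [hφle]
        intro k hk l hl
        have := hsep k hk l hl
        simp only [r] at this
        linarith
      · intro a ha b' hb' hall τ hτ
        have hdisp := hboth a b' ha.1 hb'.2 (fun τ hτ => (hφle 1 τ).1 (hall τ hτ))
        rw [hφle]
        intro k hk l hl
        have h0 := hsep k hk l hl
        have hτ₀' : τ₀ ∈ Icc a b' := ⟨ha.2, hb'.1⟩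
        have h1 := hdisp k (hIJ hk) τ₀ hτ₀' τ hτ
        have h2 := hdisp l (Finset.mem_sdiff.1 hl).1 τ hτ τ₀ hτ₀'
        have h3 := dist_triangle4 (X k τ₀) (X k τ) (X l τ) (X l τ₀)
        simp only [r] at h0
        linarith
    intro k hk τ hτ τ' hτ'
    refine (hboth s t le_rfl le_rfl (fun τ hτ => (hφle 1 τ).1 (hfar τ hτ)) k hk τ hτ τ' hτ').trans
      (le_add_of_nonneg_right (by positivity))

end Displacement

/-! ### Convergence of the explicit Euler scheme -/

section Euler

variable {E : Type*} [NormedAddCommGroup E] [NormedSpace ℝ E]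

lemma injective_id_add_smul {V : E → E} {L : ℝ≥0} (hL : LipschitzWith L V) {h : ℝ} (h0 : 0 ≤ h)
    (h1 : h * L < 1) : Function.Injective (fun x => x + h • V x) := by
  intro x y hxy
  have h2 : x - y = h • (V y - V x) := by
    rw [smul_sub, sub_eq_sub_iff_add_eq_add, add_comm _ y]
    exact hxy
  have h3 : ‖x - y‖ ≤ h * L * ‖x - y‖ := by
    calc ‖x - y‖ = h * ‖V y - V x‖ := by rw [h2, norm_smul, Real.norm_of_nonneg h0]
      _ ≤ h * (L * ‖y - x‖) := by gcongr; exact hL.norm_sub_le y x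
      _ = h * L * ‖x - y‖ := by rw [norm_sub_rev]; ring
  have h4 : ‖x - y‖ = 0 := by
    have := norm_nonneg (x - y)
    nlinarith
  exact sub_eq_zero.1 (norm_eq_zero.1 h4)

lemma norm_sub_euler_step_le {V : E → E} {L : ℝ≥0} {M : ℝ} (hL : LipschitzWith L V)
    (hM : ∀ x, ‖V x‖ ≤ M) {X : ℝ → E} {T : ℝ}
    (hX : ∀ τ ∈ Icc 0 T, HasDerivWithinAt X (V (X τ)) (Icc 0 T) τ) {s h : ℝ} (hs : 0 ≤ s)
    (hh : 0 ≤ h) (hsT : s + h ≤ T) :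
    ‖X (s + h) - (X s + h • V (X s))‖ ≤ L * M * h ^ 2 := by
  have hM0 : 0 ≤ M := (norm_nonneg _).trans (hM 0)
  have hsub : Icc s (s + h) ⊆ Icc 0 T := Icc_subset_Icc hs hsT
  have hX1 : ∀ τ ∈ Icc s (s + h), HasDerivWithinAt X (V (X τ)) (Icc s (s + h)) τ :=
    fun τ hτ => (hX τ (hsub hτ)).mono hsub
  have hs' : s ∈ Icc s (s + h) := ⟨le_rfl, by linarith⟩
  have hsh' : s + h ∈ Icc s (s + h) := ⟨by linarith, le_rfl⟩
  have hmove : ∀ τ ∈ Icc s (s + h), ‖X τ - X s‖ ≤ M * h := by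
    intro τ hτ
    refine ((convex_Icc s (s + h)).norm_image_sub_le_of_norm_hasDerivWithin_le hX1
      (fun u _ => hM (X u)) hs' hτ).trans ?_
    have : ‖τ - s‖ ≤ h := by
      rw [Real.norm_of_nonneg (by linarith [hτ.1])]
      linarith [hτ.2]
    gcongr
  have hY : ∀ τ ∈ Icc s (s + h), HasDerivWithinAt (fun τ => X τ - τ • V (X s))
      (V (X τ) - (1 : ℝ) • V (X s)) (Icc s (s + h)) τ := fun τ hτ =>
    (hX1 τ hτ).sub ((hasDerivWithinAt_id τ _).smul_const _)
  have := (convex_Icc s (s + h)).norm_image_sub_le_of_norm_hasDerivWithin_le (C := L * (M * h)) hY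
    (fun u hu => by
      rw [one_smul]
      refine (hL.norm_sub_le _ _).trans ?_
      gcongr
      exact hmove u hu) hs' hsh'
  calc _ = ‖X (s + h) - (s + h) • V (X s) - (X s - s • V (X s))‖ := by
        congr 1; rw [add_smul]; abel
    _ ≤ L * (M * h) * ‖s + h - s‖ := this
    _ = L * M * h ^ 2 := by
        rw [add_sub_cancel_left, Real.norm_of_nonneg hh]; ring

/-- Convergence of the explicit Euler scheme. -/
lemma tendsto_euler {V : E → E} {L : ℝ≥0} {M : ℝ} (hL : LipschitzWith L V)
    (hM : ∀ x, ‖V x‖ ≤ M) {X : ℝ → E} {t : ℝ} (ht : 0 ≤ t)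
    (hX : ∀ τ ∈ Icc 0 t, HasDerivWithinAt X (V (X τ)) (Icc 0 t) τ) :
    Tendsto (fun n : ℕ => (fun x => x + (t / n) • V x)^[n] (X 0)) atTop (𝓝 (X t)) := by
  have hM0 : 0 ≤ M := (norm_nonneg _).trans (hM 0)
  -- Each step adds a local error L M h² and amplifies the previous error by 1 + L h. With h = t/n
  -- and k = n the total is O(1/n).
  have herr : ∀ h, 0 ≤ h → ∀ k : ℕ, k * h ≤ t →
      ‖X (k * h) - (fun x => x + h • V x)^[k] (X 0)‖ ≤
        k * (L * M * h ^ 2) * (1 + L * h) ^ k := by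
    intro h hh k
    induction k with
    | zero => intro _; simp
    | succ k ih =>
      intro hk
      push_cast at hk ⊢
      have hk' : (k : ℝ) * h + h ≤ t := by linarith
      have ih' := ih (by linarith)
      set Y := (fun x => x + h • V x)^[k] (X 0)
      have h1 := norm_sub_euler_step_le hL hM hX (s := k * h) (by positivity) hh hk'
      have h2 : ‖(X (k * h) + h • V (X (k * h))) - (Y + h • V Y)‖ ≤
          (1 + L * h) * ‖X (k * h) - Y‖ := by
        calc _ = ‖(X (k * h) - Y) + h • (V (X (k * h)) - V Y)‖ := by
              congr 1; rw [smul_sub]; abel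
          _ ≤ ‖X (k * h) - Y‖ + h * ‖V (X (k * h)) - V Y‖ := by
              refine (norm_add_le _ _).trans_eq ?_
              rw [norm_smul, Real.norm_of_nonneg hh]
          _ ≤ ‖X (k * h) - Y‖ + h * (L * ‖X (k * h) - Y‖) := by
              gcongr; exact hL.norm_sub_le _ _
          _ = _ := by ring
      have hone : (1 : ℝ) ≤ (1 + L * h) ^ (k + 1) := one_le_pow₀ (by
        have : 0 ≤ L * h := by positivity
        linarith)
      rw [Function.iterate_succ_apply', add_mul, one_mul]
      calc _ = ‖(X (k * h + h) - (X (k * h) + h • V (X (k * h)))) +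
              ((X (k * h) + h • V (X (k * h))) - (Y + h • V Y))‖ := by congr 1; abel
        _ ≤ L * M * h ^ 2 + (1 + L * h) * (k * (L * M * h ^ 2) * (1 + L * h) ^ k) := by
            refine (norm_add_le _ _).trans (add_le_add h1 (h2.trans ?_))
            gcongr
        _ ≤ L * M * h ^ 2 * (1 + L * h) ^ (k + 1) +
            (1 + L * h) * (k * (L * M * h ^ 2) * (1 + L * h) ^ k) := by
            refine add_le_add_left ?_ _
            exact le_mul_of_one_le_right (by positivity) hone
        _ = _ := by ring
  rw [tendsto_iff_norm_sub_tendsto_zero]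
  have hlim : Tendsto (fun n : ℕ => L * M * t ^ 2 * Real.exp (L * t) / (n : ℝ)) atTop (𝓝 0) :=
    tendsto_const_div_atTop_nhds_zero_nat _
  refine squeeze_zero' (Eventually.of_forall fun _ => norm_nonneg _) ?_ hlim
  filter_upwards [eventually_gt_atTop 0] with n hn
  have hn' : (0 : ℝ) < n := by exact_mod_cast hn
  have hnt : (n : ℝ) * (t / n) = t := by field_simp
  have h := herr (t / n) (by positivity) n hnt.le
  rw [hnt] at h
  rw [norm_sub_rev]
  refine h.trans ?_
  have hexp : (1 + L * (t / n)) ^ n ≤ Real.exp (L * t) := by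
    calc (1 + L * (t / n)) ^ n ≤ (Real.exp (L * (t / n))) ^ n := by
          gcongr
          rw [add_comm]
          exact Real.add_one_le_exp _
      _ = Real.exp (L * t) := by
          rw [← Real.exp_nat_mul]
          congr 1
          rw [← hnt]; field_simp
  calc _ ≤ n * (L * M * (t / n) ^ 2) * Real.exp (L * t) := by gcongr
    _ = _ := by field_simp

end Euler

/-! ### Liouville's theorem through Euler steps, without differentiating the flow -/

section Liouville

variable {E : Type*} [NormedAddCommGroup E] [NormedSpace ℝ E] [FiniteDimensional ℝ E]

lemma differentiable_det : Differentiable ℝ (fun A : E →L[ℝ] E => A.det) := by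
  let b := Module.finBasis ℝ E
  have h : (fun A : E →L[ℝ] E => A.det) = fun A : E →L[ℝ] E =>
      ∑ σ : Equiv.Perm (Fin (Module.finrank ℝ E)), ((Equiv.Perm.sign σ : ℤ) : ℝ) *
        ∏ i, LinearMap.toMatrix b b (A : E →ₗ[ℝ] E) (σ i) i := by
    ext A
    rw [ContinuousLinearMap.det, ← LinearMap.det_toMatrix b, Matrix.det_apply']
  rw [h]
  have hentry : ∀ i j, Differentiable ℝ
      (fun A : E →L[ℝ] E => LinearMap.toMatrix b b (A : E →ₗ[ℝ] E) i j) := by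
    intro i j
    let ℓ : (E →L[ℝ] E) →ₗ[ℝ] ℝ :=
      { toFun := fun A => LinearMap.toMatrix b b (A : E →ₗ[ℝ] E) i j
        map_add' := by intros; simp
        map_smul' := by intros; simp }
    exact (LinearMap.toContinuousLinearMap ℓ).differentiable
  refine Differentiable.fun_sum fun σ _ => (differentiable_const _).mul ?_
  exact fun A => (HasFDerivAt.finsetProd fun i _ =>
    (hentry (σ i) i A).hasFDerivAt).differentiableAt

/-- In matrix form the determinant is a polynomial in r, equal to 1 + r tr B plus a multiple of r².
-/
lemma hasDerivAt_det_one_add_smul (B : E →L[ℝ] E) :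
    HasDerivAt (fun r : ℝ => (1 + r • B).det) (LinearMap.trace ℝ E B) 0 := by
  let b := Module.finBasis ℝ E
  let M := LinearMap.toMatrix b b (B : E →ₗ[ℝ] E)
  have h : (fun r : ℝ => (1 + r • B).det) = fun r : ℝ =>
      1 + M.trace * r + Polynomial.eval r (Matrix.det
        (1 + (Polynomial.X : Polynomial ℝ) • M.map Polynomial.C)).divX.divX * r ^ 2 := by
    ext r
    rw [ContinuousLinearMap.det, ← LinearMap.det_toMatrix b, ← Matrix.det_one_add_smul]
    congr 1
    ext i j
    simp [M, LinearMap.toMatrix_apply, Matrix.one_apply]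
    rw [Finsupp.single_apply]
    simp only [eq_comm]
  rw [h, LinearMap.trace_eq_matrix_trace ℝ b]
  set P := (Matrix.det
        (1 + (Polynomial.X : Polynomial ℝ) • M.map Polynomial.C)).divX.divX
  have h1 : HasDerivAt (fun r : ℝ => 1 + M.trace * r) M.trace 0 := by
    simpa using ((hasDerivAt_id (0 : ℝ)).const_mul M.trace).const_add 1
  have h2 : HasDerivAt (fun r : ℝ => P.eval r * r ^ 2) 0 0 := by
    convert! (P.hasDerivAt 0).mul (hasDerivAt_pow 2 (0 : ℝ)) using 1
    simp
  convert! h1.add h2 using 1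
  simp [M]

/-- The derivative of the determinant at the identity is the trace, so for traceless B only the
o(‖B‖) remainder is left. -/
lemma exists_one_sub_le_det_one_add {ε : ℝ} (hε : 0 < ε) :
    ∃ δ > 0, ∀ B : E →L[ℝ] E, ‖B‖ < δ → LinearMap.trace ℝ E B = 0 →
      1 - ε * ‖B‖ ≤ (1 + B).det := by
  have hd : DifferentiableAt ℝ (fun B : E →L[ℝ] E => (1 + B).det) 0 :=
    (differentiable_det (E := E)).differentiableAt.comp 0
      ((differentiableAt_const _).add differentiableAt_id)
  have hF := hd.hasFDerivAt
  have htr : ∀ B : E →L[ℝ] E, fderiv ℝ (fun B : E →L[ℝ] E => (1 + B).det) 0 B =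
      LinearMap.trace ℝ E B := by
    intro B
    have h1 : HasDerivAt (fun r : ℝ => r • B) B 0 := by
      simpa using (hasDerivAt_id (0 : ℝ)).smul_const B
    have h2 : HasDerivAt (fun r : ℝ => (1 + r • B).det)
        (fderiv ℝ (fun B : E →L[ℝ] E => (1 + B).det) 0 B) 0 :=
      HasFDerivAt.comp_hasDerivAt (l := fun B : E →L[ℝ] E => (1 + B).det)
        (f := fun r : ℝ => r • B) (0 : ℝ) (by simpa using hF) h1
    exact h2.unique (hasDerivAt_det_one_add_smul B)
  obtain ⟨δ, hδ, h⟩ := Metric.eventually_nhds_iff.1 (hF.isLittleO.def hε)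
  refine ⟨δ, hδ, fun B hB ht => ?_⟩
  have h1 := h (y := B) (by simpa using hB)
  have hone : (1 : E →L[ℝ] E).det = 1 := by
    rw [ContinuousLinearMap.det]; exact LinearMap.det_id
  simp only [sub_zero, htr, ht, add_zero, hone, Real.norm_eq_abs] at h1
  linarith [(abs_le.1 h1).1]

variable [MeasurableSpace E] [BorelSpace E] {μ : Measure E} [μ.IsAddHaarMeasure]

/-- One Euler step along a divergence-free field almost preserves volume. -/
lemma exists_lintegral_euler_step_le {V : E → E} {L : ℝ≥0} (hV : Differentiable ℝ V)
    (hL : LipschitzWith L V) (hdiv : ∀ x, LinearMap.trace ℝ E (fderiv ℝ V x) = 0)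
    {ε : ℝ} (hε : 0 < ε) :
    ∃ δ > 0, ∀ h, 0 ≤ h → h < δ → ∀ g : E → ℝ≥0∞,
      ENNReal.ofReal (1 - ε * h) * ∫⁻ x, g (x + h • V x) ∂μ ≤ ∫⁻ x, g x ∂μ := by
  obtain ⟨δ, hδ, hdet⟩ := exists_one_sub_le_det_one_add (E := E) (ε := ε / (L + 1)) (by positivity)
  -- The bound by 1 makes the Euler map injective; the bound by δ puts h DV, of norm at most h L, in
  -- the range of the determinant estimate.
  refine ⟨min δ 1 / (L + 1), by positivity, fun h h0 hh g => ?_⟩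
  have hh' : h * (L + 1) < min δ 1 := (lt_div_iff₀ (by positivity)).1 hh
  have hinj := injective_id_add_smul hL h0 (by
    have := hh'.trans_le (min_le_right _ _); linarith)
  have hder : ∀ x ∈ (univ : Set E), HasFDerivWithinAt (fun x => x + h • V x)
      (1 + h • fderiv ℝ V x) univ x := fun x _ =>
    ((hasFDerivAt_id x).add ((hV x).hasFDerivAt.const_smul h)).hasFDerivWithinAt
  have hcv := lintegral_image_eq_lintegral_abs_det_fderiv_mul μ MeasurableSet.univ hder
    hinj.injOn g
  calc ENNReal.ofReal (1 - ε * h) * ∫⁻ x, g (x + h • V x) ∂μ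
      = ∫⁻ x, ENNReal.ofReal (1 - ε * h) * g (x + h • V x) ∂μ :=
        (lintegral_const_mul' _ _ ENNReal.ofReal_ne_top).symm
    _ ≤ ∫⁻ x, ENNReal.ofReal |(1 + h • fderiv ℝ V x).det| * g (x + h • V x) ∂μ := by
        refine lintegral_mono fun x => ?_
        dsimp only
        gcongr
        refine le_trans ?_ (le_abs_self _)
        have hB : ‖h • fderiv ℝ V x‖ ≤ h * L := by
          rw [norm_smul, Real.norm_of_nonneg h0]
          gcongr
          exact norm_fderiv_le_of_lipschitz ℝ hL
        have hB' : ‖h • fderiv ℝ V x‖ < δ := by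
          have := hh'.trans_le (min_le_left _ _)
          linarith
        refine le_trans ?_ (hdet _ hB' ?_)
        · have : ε / (L + 1) * ‖h • fderiv ℝ V x‖ ≤ ε / (L + 1) * (h * (L + 1)) := by
            gcongr
            linarith
          have h2 : ε / (L + 1) * (h * (L + 1)) = ε * h := by field_simp
          linarith
        · simp [hdiv x]
    _ = ∫⁻ x in (fun x => x + h • V x) '' univ, g x ∂μ := by
        rw [hcv, Measure.restrict_univ]
    _ ≤ ∫⁻ x, g x ∂μ := setLIntegral_le_lintegral _ _

/-- **Liouville's theorem**, as an inequality: the flow of a bounded, Lipschitz, divergence-free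
vector field does not increase the integral of a nonnegative lower semicontinuous function. -/
theorem lintegral_comp_flow_le {V : E → E} {L : ℝ≥0} {M : ℝ} (hV : Differentiable ℝ V)
    (hL : LipschitzWith L V) (hM : ∀ x, ‖V x‖ ≤ M)
    (hdiv : ∀ x, LinearMap.trace ℝ E (fderiv ℝ V x) = 0) {S : Set E} (hS : MeasurableSet S)
    {t : ℝ} (ht : 0 ≤ t)
    {X : E → ℝ → E} (hX0 : ∀ x ∈ S, X x 0 = x)
    (hX : ∀ x ∈ S, ∀ τ ∈ Icc 0 t, HasDerivWithinAt (X x) (V (X x τ)) (Icc 0 t) τ)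
    {g : E → ℝ≥0∞} (hg : LowerSemicontinuous g) :
    ∫⁻ x in S, g (X x t) ∂μ ≤ ∫⁻ x, g x ∂μ := by
  set F : ℕ → E → E := fun n => (fun x => x + (t / n) • V x)^[n] with hF
  have hFc : ∀ n, Continuous (F n) := fun n =>
    (continuous_id.add (hV.continuous.const_smul _)).iterate n
  have hiter : ∀ (h c : ℝ), (∀ g : E → ℝ≥0∞,
      ENNReal.ofReal c * ∫⁻ x, g (x + h • V x) ∂μ ≤ ∫⁻ x, g x ∂μ) →
      ∀ (n : ℕ) (g : E → ℝ≥0∞), ENNReal.ofReal c ^ n *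
        ∫⁻ x, g ((fun x => x + h • V x)^[n] x) ∂μ ≤ ∫⁻ x, g x ∂μ := by
    intro h c hc n
    induction n with
    | zero => intro g; simp
    | succ n ih =>
      intro g
      have h1 := hc (fun x => g ((fun x => x + h • V x)^[n] x))
      calc _ = ENNReal.ofReal c ^ n * (ENNReal.ofReal c *
            ∫⁻ x, g ((fun x => x + h • V x)^[n] (x + h • V x)) ∂μ) := by
            simp only [Function.iterate_succ_apply]
            rw [pow_succ, mul_assoc]
        _ ≤ ENNReal.ofReal c ^ n * ∫⁻ x, g ((fun x => x + h • V x)^[n] x) ∂μ := by gcongr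
        _ ≤ _ := ih g
  have hev : ∀ ε, 0 < ε → ∀ᶠ n : ℕ in atTop,
      ENNReal.ofReal (1 - ε * t) * ∫⁻ x, g (F n x) ∂μ ≤ ∫⁻ x, g x ∂μ := by
    intro ε hε
    obtain ⟨δ, hδ, hstep⟩ := exists_lintegral_euler_step_le (μ := μ) hV hL hdiv hε
    have hlim : Tendsto (fun n : ℕ => t / (n : ℝ)) atTop (𝓝 0) :=
      tendsto_const_div_atTop_nhds_zero_nat _
    have hlim' : Tendsto (fun n : ℕ => ε * (t / (n : ℝ))) atTop (𝓝 0) := by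
      simpa using hlim.const_mul ε
    filter_upwards [hlim.eventually_lt_const hδ, hlim'.eventually_lt_const one_pos,
      eventually_gt_atTop 0] with n hn hn1 hn0
    have hn' : (0 : ℝ) < n := by exact_mod_cast hn0
    refine le_trans ?_ (hiter (t / n) (1 - ε * (t / n))
      (hstep (t / n) (by positivity) hn) n g)
    gcongr
    rw [← ENNReal.ofReal_pow (by linarith)]
    refine ENNReal.ofReal_le_ofReal ?_
    -- Bernoulli's inequality: n steps, each losing a factor 1 - ε t/n, lose at most 1 - ε t. As ε
    -- is arbitrary, nothing is lost in the limit.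
    have := one_add_mul_le_pow (a := -(ε * (t / n))) (by linarith) n
    calc 1 - ε * t = 1 + n * -(ε * (t / n)) := by field_simp; ring
      _ ≤ (1 + -(ε * (t / n))) ^ n := this
      _ = _ := by ring
  -- Lower semicontinuity of g along the convergent Euler iterates, then Fatou.
  have hbound : ∫⁻ x in S, g (X x t) ∂μ ≤ liminf (fun n => ∫⁻ x, g (F n x) ∂μ) atTop := by
    calc ∫⁻ x in S, g (X x t) ∂μ ≤ ∫⁻ x in S, liminf (fun n => g (F n x)) atTop ∂μ := by
          refine setLIntegral_mono' hS fun x hx => ?_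
          have htend := tendsto_euler hL hM ht (hX x hx)
          rw [hX0 x hx] at htend
          exact (le_liminf_iff (by isBoundedDefault) (by isBoundedDefault)).2 fun y hy =>
            htend.eventually (hg (X x t) y hy)
      _ ≤ ∫⁻ x, liminf (fun n => g (F n x)) atTop ∂μ := setLIntegral_le_lintegral _ _
      _ ≤ _ := lintegral_liminf_le fun n => hg.measurable.comp (hFc n).measurable
  refine hbound.trans ?_
  have hε : ∀ ε > 0, ENNReal.ofReal (1 - ε * t) * liminf (fun n => ∫⁻ x, g (F n x) ∂μ) atTop ≤
      ∫⁻ x, g x ∂μ := by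
    intro ε hε
    rcases eq_or_ne (ENNReal.ofReal (1 - ε * t)) 0 with h0 | h0
    · simp [h0]
    rw [mul_comm, ← ENNReal.le_div_iff_mul_le (Or.inl h0) (Or.inl ENNReal.ofReal_ne_top)]
    refine liminf_le_of_frequently_le' (Eventually.frequently ?_)
    filter_upwards [hev ε hε] with n hn
    rwa [ENNReal.le_div_iff_mul_le (Or.inl h0) (Or.inl ENNReal.ofReal_ne_top), mul_comm]
  have hlim : Tendsto (fun ε : ℝ => ENNReal.ofReal (1 - ε * t) *
      liminf (fun n => ∫⁻ x, g (F n x) ∂μ) atTop) (𝓝[>] 0)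
      (𝓝 (1 * liminf (fun n => ∫⁻ x, g (F n x) ∂μ) atTop)) := by
    refine ENNReal.Tendsto.mul_const ?_ (Or.inl one_ne_zero)
    have : Tendsto (fun ε : ℝ => ENNReal.ofReal (1 - ε * t)) (𝓝 0) (𝓝 1) := by
      have hc : Continuous fun ε : ℝ => ENNReal.ofReal (1 - ε * t) :=
        ENNReal.continuous_ofReal.comp (by fun_prop)
      simpa using hc.tendsto 0
    exact this.mono_left nhdsWithin_le_nhds
  rw [one_mul] at hlim
  exact le_of_tendsto hlim (eventually_mem_nhdsWithin.mono fun ε hε' => hε ε hε')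

end Liouville

/-! ### Rotational kernels in the plane -/

/-- Rotation of the plane by a right angle. -/
noncomputable def rot : Plane →L[ℝ] Plane :=
  LinearMap.toContinuousLinearMap
    { toFun := fun x => !₂[-x 1, x 0]
      map_add' := by intro x y; ext i; fin_cases i <;> simp [add_comm]
      map_smul' := by intro r x; ext i; fin_cases i <;> simp }

@[simp] lemma rot_apply_zero (x : Plane) : rot x 0 = -x 1 := rfl

@[simp] lemma rot_apply_one (x : Plane) : rot x 1 = x 0 := rfl

lemma inner_rot_self (x : Plane) : inner ℝ x (rot x) = 0 := by
  simp [PiLp.inner_apply, Fin.sum_univ_two]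
  ring

lemma norm_rot (x : Plane) : ‖rot x‖ = ‖x‖ := by
  simp [EuclideanSpace.norm_eq, Fin.sum_univ_two, add_comm]

/-- The velocity field `x ↦ κ(|x|²) x^⊥`. -/
noncomputable def radialKernel (κ : ℝ → ℝ) (x : Plane) : Plane := κ (‖x‖ ^ 2) • rot x

lemma radialKernel_neg (κ : ℝ → ℝ) (x : Plane) : radialKernel κ (-x) = -radialKernel κ x := by
  simp [radialKernel]

lemma inner_radialKernel_self (κ : ℝ → ℝ) (x : Plane) : inner ℝ x (radialKernel κ x) = 0 := by
  rw [radialKernel, inner_smul_right, inner_rot_self, mul_zero]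

lemma norm_radialKernel (κ : ℝ → ℝ) (x : Plane) :
    ‖radialKernel κ x‖ = |κ (‖x‖ ^ 2)| * ‖x‖ := by
  rw [radialKernel, norm_smul, norm_rot, Real.norm_eq_abs]

lemma contDiff_radialKernel {κ : ℝ → ℝ} (hκ : ContDiff ℝ ∞ κ) :
    ContDiff ℝ ∞ (radialKernel κ) :=
  (hκ.comp (contDiff_norm_sq ℝ)).smul rot.contDiff

lemma hasCompactSupport_radialKernel {κ : ℝ → ℝ} (hκ : HasCompactSupport κ) :
    HasCompactSupport (radialKernel κ) := by
  obtain ⟨ρ, hρ⟩ := hκ.isCompact.isBounded.subset_closedBall 0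
  refine HasCompactSupport.of_support_subset_isCompact (isCompact_closedBall 0 (ρ + 1)) ?_
  intro x hx
  have h1 : κ (‖x‖ ^ 2) ≠ 0 := fun h => hx (by simp [radialKernel, h])
  have h2 := hρ (subset_tsupport _ h1)
  simp only [Metric.mem_closedBall, dist_zero_right, Real.norm_eq_abs, abs_pow, abs_norm] at h2 ⊢
  nlinarith [norm_nonneg x]

/-- The gradient of κ(|x|²) is parallel to x, hence orthogonal to the rotated vector, and the
rotation itself is traceless. -/
lemma trace_fderiv_radialKernel {κ : ℝ → ℝ} (hκ : ContDiff ℝ ∞ κ) (x : Plane) :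
    LinearMap.trace ℝ Plane (fderiv ℝ (radialKernel κ) x) = 0 := by
  have h1 : HasFDerivAt (fun y : Plane => ‖y‖ ^ 2) (2 • innerSL ℝ x) x :=
    (hasStrictFDerivAt_norm_sq x).hasFDerivAt
  have h2 : HasFDerivAt (fun y : Plane => κ (‖y‖ ^ 2)) (deriv κ (‖x‖ ^ 2) • (2 • innerSL ℝ x)) x :=
    ((hκ.differentiable (by simp)) (‖x‖ ^ 2)).hasDerivAt.comp_hasFDerivAt x h1
  have h3 : HasFDerivAt (radialKernel κ) _ x := h2.smul rot.hasFDerivAt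
  rw [h3.fderiv, LinearMap.trace_eq_sum_inner _ (EuclideanSpace.basisFun (Fin 2) ℝ)]
  simp [Fin.sum_univ_two, PiLp.inner_apply]
  ring

/-! ### The vortex field on configuration space -/

section Field

variable {N : ℕ}

/-- The velocity field on the configuration space generated by the kernel `K`. -/
noncomputable def vortexField (γ : Fin N → ℝ) (K : Plane → Plane) (x : Fin N → Plane) :
    Fin N → Plane :=
  fun j => ∑ k ∈ Finset.univ.erase j, γ k • K (x j - x k)

variable {γ : Fin N → ℝ} {K : Plane → Plane}

lemma contDiff_vortexField (hK : ContDiff ℝ ∞ K) : ContDiff ℝ ∞ (vortexField γ K) := by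
  refine contDiff_pi.2 fun j => ContDiff.sum fun k _ => ContDiff.const_smul _ (hK.comp ?_)
  exact (contDiff_apply ℝ Plane j).sub (contDiff_apply ℝ Plane k)

lemma exists_norm_vortexField_le (hK : ContDiff ℝ ∞ K) (hKc : HasCompactSupport K) :
    ∃ M : ℝ, ∀ x, ‖vortexField γ K x‖ ≤ M := by
  obtain ⟨C, hC⟩ := hKc.exists_bound_of_continuous hK.continuous
  have hC0 : 0 ≤ C := (norm_nonneg _).trans (hC 0)
  refine ⟨(∑ k, |γ k|) * C, fun x => (pi_norm_le_iff_of_nonneg (by positivity)).2 fun j => ?_⟩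
  calc _ ≤ ∑ k ∈ Finset.univ.erase j, |γ k| * C := norm_sum_le_of_le _ fun k _ => by
        rw [norm_smul, Real.norm_eq_abs]
        exact mul_le_mul_of_nonneg_left (hC _) (abs_nonneg _)
    _ ≤ ∑ k, |γ k| * C := Finset.sum_le_sum_of_subset_of_nonneg (Finset.subset_univ _)
        fun _ _ _ => by positivity
    _ = _ := by rw [Finset.sum_mul]

lemma exists_lipschitzWith_vortexField (hK : ContDiff ℝ ∞ K) (hKc : HasCompactSupport K) :
    ∃ L : ℝ≥0, LipschitzWith L (vortexField γ K) := by
  obtain ⟨C, hC⟩ := ContDiff.lipschitzWith_of_hasCompactSupport hKc hK (by simp)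
  refine ⟨_, LipschitzWith.of_dist_le' (K := (∑ k, |γ k|) * (C * 2)) fun x y => ?_⟩
  rw [dist_eq_norm, dist_eq_norm]
  refine (pi_norm_le_iff_of_nonneg (by positivity)).2 fun j => ?_
  have hb : ∀ k, ‖K (x j - x k) - K (y j - y k)‖ ≤ C * 2 * ‖x - y‖ := by
    intro k
    refine (hC.norm_sub_le _ _).trans ?_
    rw [mul_assoc]
    gcongr
    calc ‖x j - x k - (y j - y k)‖ = ‖(x - y) j - (x - y) k‖ := by
          congr 1; simp only [Pi.sub_apply]; abel
      _ ≤ ‖x - y‖ + ‖x - y‖ := (norm_sub_le _ _).trans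
          (add_le_add (norm_le_pi_norm (x - y) j) (norm_le_pi_norm (x - y) k))
      _ = 2 * ‖x - y‖ := by ring
  simp only [Pi.sub_apply, vortexField, ← Finset.sum_sub_distrib, ← smul_sub]
  calc _ ≤ ∑ k ∈ Finset.univ.erase j, |γ k| * (C * 2 * ‖x - y‖) :=
        norm_sum_le_of_le _ fun k _ => by
          rw [norm_smul, Real.norm_eq_abs]
          exact mul_le_mul_of_nonneg_left (hb k) (abs_nonneg _)
    _ ≤ ∑ k, |γ k| * (C * 2 * ‖x - y‖) :=
        Finset.sum_le_sum_of_subset_of_nonneg (Finset.subset_univ _) fun _ _ _ => by positivity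
    _ = _ := by rw [← Finset.sum_mul]; ring

/-- The trace is the sum of the traces of the diagonal blocks, and the j-th block is a combination
of the traceless maps DK(x_j - x_k). -/
lemma trace_fderiv_vortexField (hK : Differentiable ℝ K)
    (hdiv : ∀ u, LinearMap.trace ℝ Plane (fderiv ℝ K u) = 0) (x : Fin N → Plane) :
    LinearMap.trace ℝ (Fin N → Plane) (fderiv ℝ (vortexField γ K) x) = 0 := by
  have hproj : ∀ j k : Fin N, HasFDerivAt (fun y : Fin N → Plane => y j - y k)
      (ContinuousLinearMap.proj (R := ℝ) (φ := fun _ : Fin N => Plane) j -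
        ContinuousLinearMap.proj k) x := fun j k =>
    (hasFDerivAt_apply j x).sub (hasFDerivAt_apply k x)
  have hF : HasFDerivAt (vortexField γ K) (ContinuousLinearMap.pi fun j =>
      ∑ k ∈ Finset.univ.erase j, γ k • (fderiv ℝ K (x j - x k)).comp
        (ContinuousLinearMap.proj (R := ℝ) (φ := fun _ : Fin N => Plane) j -
          ContinuousLinearMap.proj k)) x := by
    refine hasFDerivAt_pi.2 fun j => HasFDerivAt.fun_sum fun k _ => ?_
    exact ((hK (x j - x k)).hasFDerivAt.comp x (hproj j k)).const_smul (γ k)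
  rw [hF.fderiv]
  have hpi : ∀ A : Fin N → (Fin N → Plane) →L[ℝ] Plane,
      ((ContinuousLinearMap.pi A : (Fin N → Plane) →L[ℝ] (Fin N → Plane)) :
        (Fin N → Plane) →ₗ[ℝ] (Fin N → Plane)) =
      ∑ j, (LinearMap.single ℝ (fun _ : Fin N => Plane) j) ∘ₗ (A j : (Fin N → Plane) →ₗ[ℝ] Plane) := by
    intro A
    refine LinearMap.ext fun v => funext fun i => ?_
    simp [LinearMap.sum_apply, Finset.sum_apply, Pi.single_apply]
  rw [hpi, map_sum]
  refine Finset.sum_eq_zero fun j _ => ?_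
  rw [LinearMap.trace_comp_comm']
  have : ((∑ k ∈ Finset.univ.erase j, γ k • (fderiv ℝ K (x j - x k)).comp
        (ContinuousLinearMap.proj (R := ℝ) (φ := fun _ : Fin N => Plane) j -
          ContinuousLinearMap.proj k) : (Fin N → Plane) →L[ℝ] Plane) :
          (Fin N → Plane) →ₗ[ℝ] Plane) ∘ₗ LinearMap.single ℝ (fun _ : Fin N => Plane) j =
      ∑ k ∈ Finset.univ.erase j, γ k • (fderiv ℝ K (x j - x k) : Plane →ₗ[ℝ] Plane) := by
    refine LinearMap.ext fun v => ?_
    simp only [LinearMap.comp_apply, ContinuousLinearMap.coe_coe, LinearMap.sum_apply,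
      _root_.sum_apply]
    refine Finset.sum_congr rfl fun k hk => ?_
    simp [(Finset.mem_erase.1 hk).1]
  rw [this, map_sum]
  exact Finset.sum_eq_zero fun k _ => by rw [map_smul, hdiv, smul_zero]

end Field

/-! ### The Green kernel and its smooth truncation -/

section Green

variable {m c : ℝ}

/-- The profile `κ` for which `∇^⊥ G_m (x) = κ(|x|²) x^⊥`. -/
noncomputable def greenProfile (m c s : ℝ) : ℝ := c * (m - 2) * s ^ ((m - 4) / 2)

lemma perpGrad_green (m c : ℝ) {x : Plane} (hx : x ≠ 0) :
    perpGrad (green m c) x = radialKernel (greenProfile m c) x := by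
  have hx2 : ‖x‖ ^ 2 ≠ 0 := by simpa using hx
  have hG : green m c = fun y : Plane => c * (‖y‖ ^ 2) ^ ((m - 2) / 2) := by
    ext y
    rw [green, ← Real.rpow_natCast, ← Real.rpow_mul (norm_nonneg _)]
    congr 2
    push_cast
    ring
  have h1 : HasFDerivAt (fun y : Plane => ‖y‖ ^ 2) (2 • innerSL ℝ x) x :=
    (hasStrictFDerivAt_norm_sq x).hasFDerivAt
  have h2 : HasFDerivAt (fun y : Plane => (‖y‖ ^ 2) ^ ((m - 2) / 2))
      (((m - 2) / 2 * (‖x‖ ^ 2) ^ ((m - 2) / 2 - 1)) • (2 • innerSL ℝ x)) x :=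
    HasDerivAt.comp_hasFDerivAt (h₂ := fun s : ℝ => s ^ ((m - 2) / 2)) x
      (Real.hasDerivAt_rpow_const (Or.inl hx2)) h1
  have h3 : HasFDerivAt (green m c)
      (c • (((m - 2) / 2 * (‖x‖ ^ 2) ^ ((m - 2) / 2 - 1)) • (2 • innerSL ℝ x))) x := by
    rw [hG]
    exact h2.const_mul c
  have he : (m - 2) / 2 - 1 = (m - 4) / 2 := by ring
  rw [perpGrad, h3.fderiv, radialKernel, greenProfile, he]
  ext i
  fin_cases i <;> simp [EuclideanSpace.inner_single_right] <;> ring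

lemma norm_radialKernel_le (hc : 0 < c) (hm : m < 2) {κ : ℝ → ℝ}
    (hκ : ∀ s, |κ s| ≤ |greenProfile m c s|) (x : Plane) :
    ‖radialKernel κ x‖ ≤ c * (2 - m) * ‖x‖ ^ (m - 3) := by
  rw [norm_radialKernel]
  rcases eq_or_ne x 0 with rfl | hx
  · rw [norm_zero, mul_zero]
    have : 0 < 2 - m := by linarith
    positivity
  · have hx' : 0 < ‖x‖ := norm_pos_iff.2 hx
    calc |κ (‖x‖ ^ 2)| * ‖x‖ ≤ |greenProfile m c (‖x‖ ^ 2)| * ‖x‖ :=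
          mul_le_mul_of_nonneg_right (hκ _) (norm_nonneg _)
      _ = c * (2 - m) * (‖x‖ ^ (m - 4) * ‖x‖) := by
          have h1 : (‖x‖ ^ 2) ^ ((m - 4) / 2) = ‖x‖ ^ (m - 4) := by
            rw [← Real.rpow_natCast, ← Real.rpow_mul (norm_nonneg _)]
            congr 1
            push_cast
            ring
          rw [greenProfile, h1, abs_mul, abs_mul, abs_of_pos hc, abs_of_neg (by linarith : m - 2 < 0),
            abs_of_nonneg (by positivity : 0 ≤ ‖x‖ ^ (m - 4))]
          ring
      _ = c * (2 - m) * ‖x‖ ^ (m - 3) := by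
          rw [← Real.rpow_add_one hx'.ne']
          congr 2
          ring

/-- `κ` is a smooth cut-off of the profile of `∇^⊥ G_m`, exact at distances between `ε` and `L`. -/
structure IsCutoffProfile (m c ε L : ℝ) (κ : ℝ → ℝ) : Prop where
  contDiff : ContDiff ℝ ∞ κ
  hasCompactSupport : HasCompactSupport κ
  eq_profile : ∀ s ∈ Icc (ε ^ 2) (L ^ 2), κ s = greenProfile m c s
  abs_le : ∀ s, |κ s| ≤ |greenProfile m c s|

lemma exists_isCutoffProfile (m c : ℝ) {ε L : ℝ} (hε : 0 < ε) (hL : ε < L) :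
    ∃ κ, IsCutoffProfile m c ε L κ := by
  have hlt : ε ^ 2 < L ^ 2 := by gcongr
  have hε2 : 0 < ε ^ 2 := by positivity
  -- The inner ball is exactly [ε², L²]; the outer radius reaches down only to ε²/2 > 0, so the
  -- singularity of the profile at 0 is cut off.
  let ψ : ContDiffBump ((ε ^ 2 + L ^ 2) / 2) :=
    { rIn := (L ^ 2 - ε ^ 2) / 2
      rOut := L ^ 2 / 2
      rIn_pos := by linarith
      rIn_lt_rOut := by linarith }
  have hrOut : ψ.rOut = L ^ 2 / 2 := rfl
  have hrIn : ψ.rIn = (L ^ 2 - ε ^ 2) / 2 := rfl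
  refine ⟨fun s => ψ s * greenProfile m c s, ?_, ?_, ?_, ?_⟩
  · refine contDiff_iff_contDiffAt.2 fun s => ?_
    by_cases hs : 0 < s
    · exact ψ.contDiff.contDiffAt.mul
        (contDiffAt_const.mul (Real.contDiffAt_rpow_const_of_ne hs.ne'))
    · have : (fun s => ψ s * greenProfile m c s) =ᶠ[𝓝 s] fun _ => 0 := by
        filter_upwards [Iio_mem_nhds (show s < ε ^ 2 / 2 by linarith)] with u hu
        have hu' : u < ε ^ 2 / 2 := hu
        rw [ψ.zero_of_le_dist, zero_mul]
        rw [hrOut, Real.dist_eq]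
        refine le_trans ?_ (neg_le_abs _)
        linarith
      exact contDiffAt_const.congr_of_eventuallyEq this
  · exact ψ.hasCompactSupport.mul_right
  · intro s hs
    have : ψ s = 1 := ψ.one_of_mem_closedBall (by
      rw [Metric.mem_closedBall, hrIn, Real.dist_eq, abs_le]
      constructor <;> linarith [hs.1, hs.2])
    simp [this]
  · intro s
    rw [abs_mul, abs_of_nonneg ψ.nonneg]
    exact mul_le_of_le_one_left (abs_nonneg _) ψ.le_one

lemma IsCutoffProfile.radialKernel_eq {ε L : ℝ} {κ : ℝ → ℝ} (hκ : IsCutoffProfile m c ε L κ)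
    (hε : 0 < ε) {x : Plane} (h1 : ε ≤ ‖x‖) (h2 : ‖x‖ ≤ L) :
    radialKernel κ x = perpGrad (green m c) x := by
  rw [perpGrad_green m c (norm_pos_iff.1 (hε.trans_le h1)), radialKernel, radialKernel,
    hκ.eq_profile _ ⟨by gcongr, by gcongr⟩]

end Green

/-! ### Integrability of the singular weight -/

/-- The singular weight `|u|^{-q}`, infinite at the origin. -/
noncomputable def singularWeight (q : ℝ) (u : Plane) : ℝ≥0∞ := ENNReal.ofReal ‖u‖ ^ (-q)

lemma measurable_singularWeight (q : ℝ) : Measurable (singularWeight q) :=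
  (ENNReal.measurable_ofReal.comp measurable_norm).pow_const _

lemma singularWeight_zero {q : ℝ} (hq : 0 < q) : singularWeight q 0 = ⊤ := by
  simp [singularWeight, hq]

lemma singularWeight_of_ne_zero (q : ℝ) {u : Plane} (hu : u ≠ 0) :
    singularWeight q u = ENNReal.ofReal (‖u‖ ^ (-q)) :=
  ENNReal.ofReal_rpow_of_pos (norm_pos_iff.2 hu)

lemma singularWeight_neg (q : ℝ) (u : Plane) : singularWeight q (-u) = singularWeight q u := by
  simp [singularWeight]

lemma ofReal_rpow_norm_le_singularWeight {q : ℝ} (hq : 0 < q) (u : Plane) :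
    ENNReal.ofReal (‖u‖ ^ (-q)) ≤ singularWeight q u := by
  rcases eq_or_ne u 0 with rfl | hu
  · simp [singularWeight_zero hq]
  · exact (singularWeight_of_ne_zero q hu).ge

lemma singularWeight_le_one {q : ℝ} (hq : 0 < q) {u : Plane} (hu : 1 ≤ ‖u‖) :
    singularWeight q u ≤ 1 := by
  have hu0 : u ≠ 0 := norm_pos_iff.1 (by linarith)
  rw [singularWeight_of_ne_zero q hu0, ← ENNReal.ofReal_one]
  exact ENNReal.ofReal_le_ofReal (Real.rpow_le_one_of_one_le_of_nonpos hu (by linarith))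

/-- In polar coordinates the integrand is r^(1-q), integrable at 0 exactly when q < 2. -/
lemma setLIntegral_singularWeight_ball_lt_top {q : ℝ} (hq2 : q < 2) :
    ∫⁻ u in Metric.ball (0 : Plane) 1, singularWeight q u < ⊤ := by
  have hint : IntegrableOn (fun u : Plane => ‖u‖ ^ (-q)) (Metric.ball 0 1) := by
    refine (integrableOn_fun_norm_addHaar (volume : Measure Plane) (f := fun r => r ^ (-q))).2 ?_
    have h1 : IntegrableOn (fun y : ℝ => y ^ (1 - q)) (Ioo 0 1) :=
      (intervalIntegral.integrableOn_Ioo_rpow_iff one_pos).2 (by linarith)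
    refine h1.congr_fun (fun y hy => ?_) measurableSet_Ioo
    simp only [finrank_euclideanSpace, Fintype.card_fin, smul_eq_mul]
    rw [sub_eq_add_neg, Real.rpow_add hy.1]
    simp
  have h0 : ∀ᵐ u : Plane, u ≠ 0 := by
    simp [ae_iff]
  have heq : ∫⁻ u in Metric.ball (0 : Plane) 1, singularWeight q u =
      ∫⁻ u in Metric.ball (0 : Plane) 1, ENNReal.ofReal (‖u‖ ^ (-q)) :=
    lintegral_congr_ae ((ae_restrict_of_ae h0).mono fun u hu => singularWeight_of_ne_zero q hu)
  rw [heq]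
  exact hint.lintegral_lt_top

/-- The weight is at most its restriction to the unit ball plus 1; translation invariance of the
first integral gives uniformity in z. -/
lemma exists_setLIntegral_singularWeight_sub_le {q : ℝ} (hq : 0 < q) (hq2 : q < 2) (R : ℝ) :
    ∃ C : ℝ≥0∞, C ≠ ⊤ ∧
      ∀ z, ∫⁻ y in Metric.ball (0 : Plane) R, singularWeight q (z - y) ≤ C := by
  set w := (Metric.ball (0 : Plane) 1).indicator (singularWeight q) with hw
  refine ⟨(∫⁻ u, w u) + volume (Metric.ball (0 : Plane) R), ?_, fun z => ?_⟩
  · refine ENNReal.add_ne_top.2 ⟨?_, measure_ball_lt_top.ne⟩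
    rw [hw, lintegral_indicator measurableSet_ball]
    exact (setLIntegral_singularWeight_ball_lt_top hq2).ne
  · have hle : ∀ u, singularWeight q u ≤ w u + 1 := by
      intro u
      by_cases hu : u ∈ Metric.ball (0 : Plane) 1
      · rw [hw, indicator_of_mem hu]
        exact le_self_add
      · refine (singularWeight_le_one hq ?_).trans le_add_self
        simpa using hu
    have hwm : Measurable w := (measurable_singularWeight q).indicator measurableSet_ball
    calc _ ≤ ∫⁻ y in Metric.ball (0 : Plane) R, (w (z - y) + 1) :=
          lintegral_mono fun y => hle _
      _ = (∫⁻ y in Metric.ball (0 : Plane) R, w (z - y)) + volume (Metric.ball (0 : Plane) R) := by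
          rw [lintegral_add_right _ measurable_const, setLIntegral_one]
      _ ≤ (∫⁻ y, w (z - y)) + volume (Metric.ball (0 : Plane) R) := by
          exact add_le_add_left (setLIntegral_le_lintegral _ _) _
      _ = _ := by rw [lintegral_sub_left_eq_self w z]

/-! ### Integrals of weights over configurations -/

section Configuration

variable {N : ℕ}

/-- Integrating out one vortex against the singular weight costs a constant. -/
lemma exists_setLIntegral_mul_singularWeight_le {q R : ℝ} (hq : 0 < q) (hq2 : q < 2)
    (hR : 0 < R) :
    ∃ C : ℝ≥0∞, C ≠ ⊤ ∧ ∀ (G : (Fin N → Plane) → ℝ≥0∞), Measurable G → ∀ i k, i ≠ k →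
      (∀ x y, G (Function.update x k y) = G x) →
      ∫⁻ x in Metric.ball (0 : Fin N → Plane) R, G x * singularWeight q (x i - x k) ≤
        C * ∫⁻ x in Metric.ball (0 : Fin N → Plane) R, G x := by
  obtain ⟨C, hC, hCb⟩ := exists_setLIntegral_singularWeight_sub_le hq hq2 R
  set b := Metric.ball (0 : Plane) R with hb
  set v := volume b with hv
  have hv0 : v ≠ 0 := (Metric.measure_ball_pos volume 0 hR).ne'
  have hvt : v ≠ ⊤ := measure_ball_lt_top.ne
  refine ⟨C / v, ENNReal.div_ne_top hC hv0, fun G hG i k hik hGk => ?_⟩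
  have hwm : Measurable fun x : Fin N → Plane => singularWeight q (x i - x k) :=
    (measurable_singularWeight q).comp ((measurable_pi_apply i).sub (measurable_pi_apply k))
  rw [← lintegral_const_mul _ hG, ← lintegral_indicator measurableSet_ball,
    ← lintegral_indicator measurableSet_ball]
  refine lintegral_le_of_lmarginal_le (μ := fun _ : Fin N => (volume : Measure Plane)) {k}
    ((hG.mul hwm).indicator measurableSet_ball)
    ((measurable_const.mul hG).indicator measurableSet_ball) ?_
  rw [lmarginal_singleton, lmarginal_singleton]
  intro x
  have hmem : ∀ y, Function.update x k y ∈ Metric.ball (0 : Fin N → Plane) R ↔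
      (∀ l, l ≠ k → x l ∈ b) ∧ y ∈ b := by
    intro y
    simp only [hb, mem_ball_zero_iff, pi_norm_lt_iff hR]
    constructor
    · intro h
      exact ⟨fun l hl => by simpa [hl] using h l, by simpa using h k⟩
    · rintro ⟨h1, h2⟩ l
      rcases eq_or_ne l k with rfl | hl
      · simpa using h2
      · simpa [hl] using h1 l hl
  by_cases hx : ∀ l, l ≠ k → x l ∈ b
  · have h1 : ∀ F : Plane → ℝ≥0∞, ∀ H : (Fin N → Plane) → ℝ≥0∞,
        (∀ y, H (Function.update x k y) = F y) →
        ∫⁻ y, (Metric.ball (0 : Fin N → Plane) R).indicator H (Function.update x k y) =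
          ∫⁻ y in b, F y := by
      intro F H hFH
      rw [← lintegral_indicator measurableSet_ball]
      refine lintegral_congr fun y => ?_
      by_cases hy : y ∈ b
      · rw [indicator_of_mem ((hmem y).2 ⟨hx, hy⟩), indicator_of_mem hy, hFH]
      · rw [indicator_of_notMem (fun h => hy ((hmem y).1 h).2), indicator_of_notMem hy]
    have hxm : Measurable fun y => singularWeight q (x i - y) :=
      (measurable_singularWeight q).comp (measurable_const.sub measurable_id)
    dsimp only
    rw [h1 (fun y => G x * singularWeight q (x i - y)) _ (fun y => by simp [hGk, hik]),
      h1 (fun _ => C / v * G x) _ (fun y => by simp [hGk]), setLIntegral_const,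
      lintegral_const_mul _ hxm]
    calc G x * ∫⁻ y in b, singularWeight q (x i - y) ≤ G x * C := by gcongr; exact hCb _
      _ = C / v * G x * v := by
        rw [mul_right_comm, ENNReal.div_mul_cancel hv0 hvt, mul_comm]
  · have h1 : ∀ H : (Fin N → Plane) → ℝ≥0∞,
        ∫⁻ y, (Metric.ball (0 : Fin N → Plane) R).indicator H (Function.update x k y) = 0 := by
      intro H
      rw [← lintegral_zero]
      refine lintegral_congr fun y => ?_
      rw [indicator_of_notMem (fun h => hx ((hmem y).1 h).1)]
    dsimp only
    rw [h1, h1]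

lemma setLIntegral_singularWeight_lt_top {q R : ℝ} (hq : 0 < q) (hq2 : q < 2) (hR : 0 < R)
    {i j : Fin N} (hij : i ≠ j) :
    ∫⁻ x in Metric.ball (0 : Fin N → Plane) R, singularWeight q (x i - x j) < ⊤ := by
  obtain ⟨C, hC, h⟩ := exists_setLIntegral_mul_singularWeight_le (N := N) hq hq2 hR
  have := h (fun _ => 1) measurable_const i j hij (fun _ _ => rfl)
  simp only [one_mul, setLIntegral_one] at this
  exact this.trans_lt (ENNReal.mul_lt_top hC.lt_top measure_ball_lt_top)

/-- The vortex k occurs in only one factor. Integrating it out first leaves a single weight, so q <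
2 suffices although two singularities are multiplied. -/
lemma setLIntegral_singularWeight_mul_lt_top {q R : ℝ} (hq : 0 < q) (hq2 : q < 2) (hR : 0 < R)
    {i j k : Fin N} (hij : i ≠ j) (hik : i ≠ k) (hjk : j ≠ k) :
    ∫⁻ x in Metric.ball (0 : Fin N → Plane) R,
      singularWeight q (x i - x j) * singularWeight q (x i - x k) < ⊤ := by
  obtain ⟨C, hC, h⟩ := exists_setLIntegral_mul_singularWeight_le (N := N) hq hq2 hR
  refine (h (fun x => singularWeight q (x i - x j)) ?_ i k hik ?_).trans_lt ?_
  · exact (measurable_singularWeight q).comp ((measurable_pi_apply i).sub (measurable_pi_apply j))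
  · intro x y
    simp [hik, hjk]
  · exact ENNReal.mul_lt_top hC.lt_top (setLIntegral_singularWeight_lt_top hq hq2 hR hij)

end Configuration

/-! ### The regularized energy and its rate of change -/

section Lyapunov

variable {N : ℕ} {m c ε : ℝ}

/-- A regularized interaction energy of a configuration; it is large near collisions. -/
noncomputable def lyapunov (m ε : ℝ) (x : Fin N → Plane) : ℝ :=
  ∑ i, ∑ j ∈ Finset.univ.erase i, (‖x i - x j‖ ^ 2 + ε ^ 2) ^ ((m - 2) / 2)

/-- The derivative of `lyapunov` at `x` in the direction `v`. -/
noncomputable def lyapunovRate (m ε : ℝ) (x v : Fin N → Plane) : ℝ :=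
  ∑ i, ∑ j ∈ Finset.univ.erase i, (m - 2) * (‖x i - x j‖ ^ 2 + ε ^ 2) ^ ((m - 4) / 2) *
    inner ℝ (x i - x j) (v i - v j)

lemma hasDerivWithinAt_lyapunov (m : ℝ) (hε : 0 < ε) {X : ℝ → Fin N → Plane} {v : Fin N → Plane}
    {s : Set ℝ} {t : ℝ} (hX : HasDerivWithinAt X v s t) :
    HasDerivWithinAt (fun τ => lyapunov m ε (X τ)) (lyapunovRate m ε (X t) v) s t := by
  refine HasDerivWithinAt.fun_sum fun i _ => HasDerivWithinAt.fun_sum fun j _ => ?_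
  have hi := hasDerivWithinAt_pi.1 hX i
  have hj := hasDerivWithinAt_pi.1 hX j
  have h1 := ((hi.sub hj).norm_sq).add_const (ε ^ 2)
  have hpos : ‖X t i - X t j‖ ^ 2 + ε ^ 2 ≠ 0 := by positivity
  have h2 := h1.rpow_const (p := (m - 2) / 2) (Or.inl hpos)
  refine h2.congr_deriv ?_
  have he : (m - 2) / 2 - 1 = (m - 4) / 2 := by ring
  simp only [Pi.sub_apply]
  rw [he]
  ring

lemma continuous_lyapunov (m : ℝ) (hε : 0 < ε) :
    Continuous (lyapunov m ε : (Fin N → Plane) → ℝ) := by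
  refine continuous_finsetSum _ fun i _ => continuous_finsetSum _ fun j _ => ?_
  refine Continuous.rpow_const (by fun_prop) fun x => Or.inl ?_
  positivity

lemma continuous_lyapunovRate (m : ℝ) (hε : 0 < ε) {V : (Fin N → Plane) → Fin N → Plane}
    (hV : Continuous V) : Continuous fun x => lyapunovRate m ε x (V x) := by
  refine continuous_finsetSum _ fun i _ => continuous_finsetSum _ fun j _ => ?_
  refine Continuous.mul (continuous_const.mul ?_) ?_
  · refine Continuous.rpow_const (by fun_prop) fun x => Or.inl ?_
    positivity
  · exact Continuous.inner (by fun_prop) (by fun_prop)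

/-- In the relative velocity of two vortices, the component along their separation is due to the
other vortices only. -/
lemma abs_inner_vortexField_sub_le {γ : Fin N → ℝ} {K : Plane → Plane}
    (hK : ∀ u, K (-u) = -K u) (hK0 : ∀ u, inner ℝ u (K u) = 0) {p : Plane → ℝ}
    (hp : ∀ u, ‖K u‖ ≤ p u) (x : Fin N → Plane) {i j : Fin N} (hij : i ≠ j) :
    |inner ℝ (x i - x j) (vortexField γ K x i - vortexField γ K x j)| ≤
      ‖x i - x j‖ * ∑ k ∈ (Finset.univ.erase i).erase j,
        (∑ l, |γ l|) * (p (x i - x k) + p (x j - x k)) := by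
  have hi : vortexField γ K x i = γ j • K (x i - x j) +
      ∑ k ∈ (Finset.univ.erase i).erase j, γ k • K (x i - x k) :=
    (Finset.add_sum_erase _ _ (Finset.mem_erase.2 ⟨hij.symm, Finset.mem_univ j⟩)).symm
  have hj : vortexField γ K x j = γ i • K (x j - x i) +
      ∑ k ∈ (Finset.univ.erase i).erase j, γ k • K (x j - x k) := by
    rw [Finset.erase_right_comm]
    exact (Finset.add_sum_erase _ _ (Finset.mem_erase.2 ⟨hij, Finset.mem_univ i⟩)).symm
  have hsplit : inner ℝ (x i - x j) (vortexField γ K x i - vortexField γ K x j) =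
      inner ℝ (x i - x j) (∑ k ∈ (Finset.univ.erase i).erase j,
        (γ k • K (x i - x k) - γ k • K (x j - x k))) := by
    rw [hi, hj, ← neg_sub (x i) (x j), hK, Finset.sum_sub_distrib]
    simp only [inner_sub_right, inner_add_right, inner_smul_right, inner_neg_right, hK0]
    ring
  rw [hsplit]
  refine (abs_real_inner_le_norm _ _).trans ?_
  refine mul_le_mul_of_nonneg_left (norm_sum_le_of_le _ fun k _ => ?_) (norm_nonneg _)
  rw [← smul_sub, norm_smul, Real.norm_eq_abs]
  have h1 : |γ k| ≤ ∑ l, |γ l| :=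
    Finset.single_le_sum (f := fun l => |γ l|) (fun _ _ => abs_nonneg _) (Finset.mem_univ k)
  gcongr
  exact (norm_sub_le _ _).trans (add_le_add (hp _) (hp _))

lemma rpow_add_sq_mul_norm_le (hm : m < 2) (ε : ℝ) (u : Plane) :
    (‖u‖ ^ 2 + ε ^ 2) ^ ((m - 4) / 2) * ‖u‖ ≤ ‖u‖ ^ (m - 3) := by
  rcases eq_or_ne u 0 with rfl | hu
  · rw [norm_zero, mul_zero]
    positivity
  have hu' : 0 < ‖u‖ := norm_pos_iff.2 hu
  have h1 : (‖u‖ ^ 2) ^ ((m - 4) / 2) = ‖u‖ ^ (m - 4) := by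
    rw [← Real.rpow_natCast, ← Real.rpow_mul (norm_nonneg _)]
    congr 1
    push_cast
    ring
  calc _ ≤ (‖u‖ ^ 2) ^ ((m - 4) / 2) * ‖u‖ := by
        refine mul_le_mul_of_nonneg_right ?_ hu'.le
        exact Real.rpow_le_rpow_of_nonpos (by positivity)
          (le_add_of_nonneg_right (sq_nonneg ε)) (by linarith)
    _ = ‖u‖ ^ (m - 3) := by
        rw [h1, ← Real.rpow_add_one hu'.ne']
        congr 1
        ring

/-- The singular majorant of the rate of change of `lyapunov`. -/
noncomputable def rateMajorant (N : ℕ) (q : ℝ) (x : Fin N → Plane) : ℝ≥0∞ :=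
  ∑ i, ∑ j ∈ Finset.univ.erase i, ∑ k ∈ (Finset.univ.erase i).erase j,
    (singularWeight q (x i - x j) * singularWeight q (x i - x k) +
      singularWeight q (x i - x j) * singularWeight q (x j - x k))

lemma measurable_singularWeight_sub (q : ℝ) (i j : Fin N) :
    Measurable fun x : Fin N → Plane => singularWeight q (x i - x j) :=
  (measurable_singularWeight q).comp ((measurable_pi_apply i).sub (measurable_pi_apply j))

lemma setLIntegral_rateMajorant_lt_top {q R : ℝ} (hq : 0 < q) (hq2 : q < 2) (hR : 0 < R) :
    ∫⁻ x in Metric.ball (0 : Fin N → Plane) R, rateMajorant N q x < ⊤ := by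
  have hm1 : ∀ i j k : Fin N, Measurable fun x : Fin N → Plane =>
      singularWeight q (x i - x j) * singularWeight q (x i - x k) := fun i j k =>
    (measurable_singularWeight_sub q i j).mul (measurable_singularWeight_sub q i k)
  have hm2 : ∀ i j k : Fin N, Measurable fun x : Fin N → Plane =>
      singularWeight q (x i - x j) * singularWeight q (x j - x k) := fun i j k =>
    (measurable_singularWeight_sub q i j).mul (measurable_singularWeight_sub q j k)
  have hm12 : ∀ i j k : Fin N, Measurable fun x : Fin N → Plane =>
      singularWeight q (x i - x j) * singularWeight q (x i - x k) +
        singularWeight q (x i - x j) * singularWeight q (x j - x k) := fun i j k =>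
    (hm1 i j k).add (hm2 i j k)
  simp only [rateMajorant]
  rw [lintegral_finsetSum _ fun i _ => Finset.measurable_fun_sum _ fun j _ =>
    Finset.measurable_fun_sum _ fun k _ => hm12 i j k]
  refine ENNReal.sum_lt_top.2 fun i _ => ?_
  rw [lintegral_finsetSum _ fun j _ =>
    Finset.measurable_fun_sum _ fun k _ => hm12 i j k]
  refine ENNReal.sum_lt_top.2 fun j hj => ?_
  rw [lintegral_finsetSum _ fun k _ => hm12 i j k]
  refine ENNReal.sum_lt_top.2 fun k hk => ?_
  rw [lintegral_add_left (hm1 i j k)]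
  have hij : i ≠ j := (Finset.mem_erase.1 hj).1.symm
  have hjk : j ≠ k := (Finset.mem_erase.1 hk).1.symm
  have hik : i ≠ k := (Finset.mem_erase.1 (Finset.mem_erase.1 hk).2).1.symm
  refine ENNReal.add_lt_top.2 ⟨setLIntegral_singularWeight_mul_lt_top hq hq2 hR hij hik hjk, ?_⟩
  have := setLIntegral_singularWeight_mul_lt_top (N := N) hq hq2 hR hij.symm hjk hik
  refine lt_of_eq_of_lt ?_ this
  refine lintegral_congr fun x => ?_
  rw [← neg_sub (x j) (x i), singularWeight_neg]

lemma ofReal_abs_lyapunovRate_le (hc : 0 < c) (hm : m < 2) {γ : Fin N → ℝ} {κ : ℝ → ℝ}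
    (hκ : ∀ s, |κ s| ≤ |greenProfile m c s|) (x : Fin N → Plane) :
    ENNReal.ofReal |lyapunovRate m ε x (vortexField γ (radialKernel κ) x)| ≤
      ENNReal.ofReal ((2 - m) * ((∑ l, |γ l|) * (c * (2 - m)))) * rateMajorant N (3 - m) x := by
  set Γ := ∑ l, |γ l|
  set A := (2 - m) * (Γ * (c * (2 - m))) with hA
  have hΓ : 0 ≤ Γ := Finset.sum_nonneg fun _ _ => abs_nonneg _
  have h2m : 0 < 2 - m := by linarith
  have hA0 : 0 ≤ A := by positivity
  let p : Plane → ℝ := fun u => ‖u‖ ^ (m - 3)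
  have hp0 : ∀ u, 0 ≤ p u := fun u => by positivity
  have hpw : ∀ u, ENNReal.ofReal (p u) ≤ singularWeight (3 - m) u := fun u => by
    have := ofReal_rpow_norm_le_singularWeight (q := 3 - m) (by linarith) u
    rwa [neg_sub] at this
  have hreal : |lyapunovRate m ε x (vortexField γ (radialKernel κ) x)| ≤
      ∑ i, ∑ j ∈ Finset.univ.erase i, ∑ k ∈ (Finset.univ.erase i).erase j,
        A * (p (x i - x j) * p (x i - x k) + p (x i - x j) * p (x j - x k)) := by
    refine (Finset.abs_sum_le_sum_abs _ _).trans (Finset.sum_le_sum fun i _ => ?_)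
    refine (Finset.abs_sum_le_sum_abs _ _).trans (Finset.sum_le_sum fun j hj => ?_)
    have hij : i ≠ j := (Finset.mem_erase.1 hj).1.symm
    have h1 := abs_inner_vortexField_sub_le (γ := γ) (radialKernel_neg κ)
      (inner_radialKernel_self κ) (norm_radialKernel_le hc hm hκ) x hij
    set S := ∑ k ∈ (Finset.univ.erase i).erase j,
      Γ * (c * (2 - m) * ‖x i - x k‖ ^ (m - 3) + c * (2 - m) * ‖x j - x k‖ ^ (m - 3))
    have hS : 0 ≤ S := Finset.sum_nonneg fun k _ => by positivity
    have hbase : 0 ≤ ‖x i - x j‖ ^ 2 + ε ^ 2 := by positivity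
    rw [abs_mul, abs_mul, abs_of_neg (by linarith : m - 2 < 0),
      abs_of_nonneg (Real.rpow_nonneg hbase _)]
    calc _ ≤ -(m - 2) * (‖x i - x j‖ ^ 2 + ε ^ 2) ^ ((m - 4) / 2) * (‖x i - x j‖ * S) :=
          mul_le_mul_of_nonneg_left h1 (mul_nonneg (by linarith) (Real.rpow_nonneg hbase _))
      _ = (2 - m) * (((‖x i - x j‖ ^ 2 + ε ^ 2) ^ ((m - 4) / 2) * ‖x i - x j‖) * S) := by ring
      _ ≤ (2 - m) * (p (x i - x j) * S) := by
          refine mul_le_mul_of_nonneg_left (mul_le_mul_of_nonneg_right ?_ hS) h2m.le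
          exact rpow_add_sq_mul_norm_le hm ε _
      _ = _ := by
          rw [Finset.mul_sum, Finset.mul_sum]
          refine Finset.sum_congr rfl fun k _ => ?_
          simp only [p, hA]
          ring
  refine (ENNReal.ofReal_le_ofReal hreal).trans ?_
  have hterm : ∀ i j k : Fin N,
      0 ≤ A * (p (x i - x j) * p (x i - x k) + p (x i - x j) * p (x j - x k)) := fun i j k =>
    mul_nonneg hA0 (add_nonneg (mul_nonneg (hp0 _) (hp0 _)) (mul_nonneg (hp0 _) (hp0 _)))
  rw [rateMajorant, ENNReal.ofReal_sum_of_nonneg fun i _ => Finset.sum_nonneg fun j _ =>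
    Finset.sum_nonneg fun k _ => hterm i j k, Finset.mul_sum]
  refine Finset.sum_le_sum fun i _ => ?_
  rw [ENNReal.ofReal_sum_of_nonneg fun j _ => Finset.sum_nonneg fun k _ => hterm i j k,
    Finset.mul_sum]
  refine Finset.sum_le_sum fun j _ => ?_
  rw [ENNReal.ofReal_sum_of_nonneg fun k _ => hterm i j k, Finset.mul_sum]
  refine Finset.sum_le_sum fun k _ => ?_
  rw [ENNReal.ofReal_mul hA0, ENNReal.ofReal_add (mul_nonneg (hp0 _) (hp0 _))
    (mul_nonneg (hp0 _) (hp0 _)), ENNReal.ofReal_mul (hp0 _), ENNReal.ofReal_mul (hp0 _)]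
  gcongr <;> exact hpw _

/-- A majorant of `lyapunov`, uniform in the regularization. -/
noncomputable def lyapunovMajorant (N : ℕ) (q : ℝ) (x : Fin N → Plane) : ℝ≥0∞ :=
  ∑ i, ∑ j ∈ Finset.univ.erase i, (1 + singularWeight q (x i - x j))

lemma setLIntegral_lyapunovMajorant_lt_top {q R : ℝ} (hq : 0 < q) (hq2 : q < 2) (hR : 0 < R) :
    ∫⁻ x in Metric.ball (0 : Fin N → Plane) R, lyapunovMajorant N q x < ⊤ := by
  have hm : ∀ i j : Fin N, Measurable fun x : Fin N → Plane =>
      1 + singularWeight q (x i - x j) := fun i j =>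
    measurable_const.add (measurable_singularWeight_sub q i j)
  simp only [lyapunovMajorant]
  rw [lintegral_finsetSum _ fun i _ => Finset.measurable_fun_sum _ fun j _ => hm i j]
  refine ENNReal.sum_lt_top.2 fun i _ => ?_
  rw [lintegral_finsetSum _ fun j _ => hm i j]
  refine ENNReal.sum_lt_top.2 fun j hj => ?_
  rw [lintegral_add_left measurable_const, setLIntegral_one]
  exact ENNReal.add_lt_top.2 ⟨measure_ball_lt_top,
    setLIntegral_singularWeight_lt_top hq hq2 hR (Finset.mem_erase.1 hj).1.symm⟩

/-- The energy has the singularity |u|^(m-2), weaker than |u|^(m-3) for |u| ≤ 1 and at most 1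
beyond, so the exponent of the rate estimate can be reused. -/
lemma ofReal_lyapunov_le (hm : m < 2) (ε : ℝ) (x : Fin N → Plane) :
    ENNReal.ofReal (lyapunov m ε x) ≤ lyapunovMajorant N (3 - m) x := by
  have hnn : ∀ i j, 0 ≤ (‖x i - x j‖ ^ 2 + ε ^ 2) ^ ((m - 2) / 2) := fun i j => by positivity
  rw [lyapunov, lyapunovMajorant,
    ENNReal.ofReal_sum_of_nonneg fun i _ => Finset.sum_nonneg fun j _ => hnn i j]
  refine Finset.sum_le_sum fun i _ => ?_
  rw [ENNReal.ofReal_sum_of_nonneg fun j _ => hnn i j]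
  refine Finset.sum_le_sum fun j _ => ?_
  generalize x i - x j = u
  rcases eq_or_ne u 0 with rfl | hu
  · simp [singularWeight_zero (show (0 : ℝ) < 3 - m by linarith)]
  have hu' : 0 < ‖u‖ := norm_pos_iff.2 hu
  have h1 : (‖u‖ ^ 2 + ε ^ 2) ^ ((m - 2) / 2) ≤ ‖u‖ ^ (m - 2) := by
    calc _ ≤ (‖u‖ ^ 2) ^ ((m - 2) / 2) :=
          Real.rpow_le_rpow_of_nonpos (by positivity)
            (le_add_of_nonneg_right (sq_nonneg ε)) (by linarith)
      _ = ‖u‖ ^ (m - 2) := by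
          rw [← Real.rpow_natCast, ← Real.rpow_mul (norm_nonneg _)]
          congr 1
          push_cast
          ring
  rw [singularWeight_of_ne_zero _ hu, ← ENNReal.ofReal_one,
    ← ENNReal.ofReal_add zero_le_one (by positivity)]
  refine ENNReal.ofReal_le_ofReal (h1.trans ?_)
  rw [neg_sub]
  rcases le_total 1 ‖u‖ with h | h
  · have := Real.rpow_le_one_of_one_le_of_nonpos h (show m - 2 ≤ 0 by linarith)
    have h3 : 0 ≤ ‖u‖ ^ (m - 3) := by positivity
    linarith
  · have := Real.rpow_le_rpow_of_exponent_ge hu' h (show m - 3 ≤ m - 2 by linarith)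
    linarith

/-- All terms are nonnegative, and a single pair within distance ε already contributes the
threshold. -/
lemma lt_norm_of_lyapunov_lt (hm : m < 2) (hε : 0 < ε) {x : Fin N → Plane}
    (hx : lyapunov m ε x < (2 * ε ^ 2) ^ ((m - 2) / 2)) {i j : Fin N} (hij : i ≠ j) :
    ε < ‖x i - x j‖ := by
  have hnn : ∀ i j, 0 ≤ (‖x i - x j‖ ^ 2 + ε ^ 2) ^ ((m - 2) / 2) := fun i j => by positivity
  have h1 : (‖x i - x j‖ ^ 2 + ε ^ 2) ^ ((m - 2) / 2) ≤ lyapunov m ε x := by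
    refine le_trans ?_ (Finset.single_le_sum (f := fun i => ∑ j ∈ Finset.univ.erase i,
      (‖x i - x j‖ ^ 2 + ε ^ 2) ^ ((m - 2) / 2))
      (fun i _ => Finset.sum_nonneg fun j _ => hnn i j) (Finset.mem_univ i))
    exact Finset.single_le_sum (f := fun j => (‖x i - x j‖ ^ 2 + ε ^ 2) ^ ((m - 2) / 2))
      (fun j _ => hnn i j) (Finset.mem_erase.2 ⟨hij.symm, Finset.mem_univ j⟩)
  by_contra! h
  have h2 : ‖x i - x j‖ ^ 2 + ε ^ 2 ≤ 2 * ε ^ 2 := by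
    have : ‖x i - x j‖ ^ 2 ≤ ε ^ 2 := by gcongr
    linarith
  have h3 := Real.rpow_le_rpow_of_nonpos (z := (m - 2) / 2)
    (by positivity : 0 < ‖x i - x j‖ ^ 2 + ε ^ 2) h2 (by linarith)
  linarith

end Lyapunov

/-! ### Separated solutions: uniqueness, smoothness, patching -/

lemma ofReal_le_add_lintegral_abs_deriv {f f' : ℝ → ℝ} {T t : ℝ} (ht : t ∈ Icc 0 T)
    (hf : ∀ τ ∈ Icc 0 T, HasDerivWithinAt f (f' τ) (Icc 0 T) τ)
    (hf' : ContinuousOn f' (Icc 0 T)) :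
    ENNReal.ofReal (f t) ≤ ENNReal.ofReal (f 0) + ∫⁻ s in Icc 0 T, ENNReal.ofReal |f' s| := by
  have hsub : Icc 0 t ⊆ Icc 0 T := Icc_subset_Icc_right ht.2
  have hint : IntervalIntegrable f' volume 0 t :=
    ContinuousOn.intervalIntegrable_of_Icc ht.1 (hf'.mono hsub)
  have hftc : ∫ s in (0 : ℝ)..t, f' s = f t - f 0 :=
    intervalIntegral.integral_eq_sub_of_hasDerivAt_of_le ht.1
      ((HasDerivWithinAt.continuousOn hf).mono hsub)
      (fun τ hτ => (hf τ (hsub (Ioo_subset_Icc_self hτ))).hasDerivAt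
        (Icc_mem_nhds hτ.1 (hτ.2.trans_le ht.2))) hint
  have hle : f t ≤ f 0 + ∫ s in Ioc 0 t, |f' s| := by
    have h1 : ∫ s in (0 : ℝ)..t, f' s ≤ ∫ s in (0 : ℝ)..t, |f' s| :=
      intervalIntegral.integral_mono_on ht.1 hint hint.abs fun s _ => le_abs_self _
    rw [intervalIntegral.integral_of_le ht.1 (f := fun s => |f' s|)] at h1
    linarith
  have hI : Integrable (fun s => |f' s|) (volume.restrict (Ioc 0 t)) :=
    ((intervalIntegrable_iff_integrableOn_Ioc_of_le ht.1).1 hint).abs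
  calc ENNReal.ofReal (f t) ≤ ENNReal.ofReal (f 0 + ∫ s in Ioc 0 t, |f' s|) :=
        ENNReal.ofReal_le_ofReal hle
    _ ≤ ENNReal.ofReal (f 0) + ENNReal.ofReal (∫ s in Ioc 0 t, |f' s|) := ENNReal.ofReal_add_le
    _ = ENNReal.ofReal (f 0) + ∫⁻ s in Ioc 0 t, ENNReal.ofReal |f' s| := by
        rw [ofReal_integral_eq_lintegral_ofReal hI (Eventually.of_forall fun s => abs_nonneg _)]
    _ ≤ _ := by
        refine add_le_add_right (lintegral_mono_set ?_) _
        exact Ioc_subset_Icc_self.trans hsub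

variable {N : ℕ} {m c : ℝ} {γ : Fin N → ℝ}

/-- `Y` solves the vortex system on `[0, T]`, with all mutual distances between `δ` and `L`. -/
structure IsSeparatedSolution (m c : ℝ) (γ : Fin N → ℝ) (T δ L : ℝ) (x : Fin N → Plane)
    (Y : ℝ → Fin N → Plane) : Prop where
  initial : Y 0 = x
  motion : ∀ τ ∈ Icc 0 T,
    HasDerivWithinAt Y (vortexField γ (perpGrad (green m c)) (Y τ)) (Icc 0 T) τ
  separated : ∀ τ ∈ Icc 0 T, ∀ i j, i ≠ j → ‖Y τ i - Y τ j‖ ∈ Icc δ L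

lemma IsCutoffProfile.vortexField_eq {ε L : ℝ} {κ : ℝ → ℝ} (hκ : IsCutoffProfile m c ε L κ)
    (hε : 0 < ε) {x : Fin N → Plane} (hx : ∀ i j, i ≠ j → ‖x i - x j‖ ∈ Icc ε L) :
    vortexField γ (radialKernel κ) x = vortexField γ (perpGrad (green m c)) x := by
  funext j
  refine Finset.sum_congr rfl fun k hk => ?_
  have h := hx j k (Finset.mem_erase.1 hk).1.symm
  rw [hκ.radialKernel_eq hε h.1 h.2]

lemma IsSeparatedSolution.motion_cutoff {T δ L ε R : ℝ} {κ : ℝ → ℝ} {x : Fin N → Plane}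
    {Y : ℝ → Fin N → Plane} (hY : IsSeparatedSolution m c γ T δ L x Y)
    (hκ : IsCutoffProfile m c ε R κ) (hε : 0 < ε) (hεδ : ε ≤ δ) (hLR : L ≤ R) :
    ∀ τ ∈ Icc 0 T, HasDerivWithinAt Y (vortexField γ (radialKernel κ) (Y τ)) (Icc 0 T) τ := by
  intro τ hτ
  rw [hκ.vortexField_eq hε fun i j hij => ⟨hεδ.trans (hY.separated τ hτ i j hij).1,
    (hY.separated τ hτ i j hij).2.trans hLR⟩]
  exact hY.motion τ hτ

/-- A truncation exact on both ranges of distances makes both curves solve one system with a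
globally Lipschitz field. -/
lemma IsSeparatedSolution.eqOn {T₁ T₂ δ₁ δ₂ L₁ L₂ : ℝ} {x : Fin N → Plane}
    {Y₁ Y₂ : ℝ → Fin N → Plane} (hδ₁ : 0 < δ₁) (hδ₂ : 0 < δ₂)
    (h₁ : IsSeparatedSolution m c γ T₁ δ₁ L₁ x Y₁) (h₂ : IsSeparatedSolution m c γ T₂ δ₂ L₂ x Y₂)
    (hT : T₁ ≤ T₂) : EqOn Y₁ Y₂ (Icc 0 T₁) := by
  set ε := min δ₁ δ₂
  have hε : 0 < ε := lt_min hδ₁ hδ₂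
  set R := max (max L₁ L₂) (ε + 1)
  obtain ⟨κ, hκ⟩ := exists_isCutoffProfile m c hε
    (show ε < R from (lt_add_one ε).trans_le (le_max_right _ _))
  obtain ⟨Λ, hΛ⟩ := exists_lipschitzWith_vortexField (γ := γ) (contDiff_radialKernel hκ.contDiff)
    (hasCompactSupport_radialKernel hκ.hasCompactSupport)
  have hm₁ := h₁.motion_cutoff hκ hε (min_le_left _ _) ((le_max_left _ _).trans (le_max_left _ _))
  have hm₂ := fun τ (hτ : τ ∈ Icc 0 T₁) =>
    (h₂.motion_cutoff hκ hε (min_le_right _ _) ((le_max_right _ _).trans (le_max_left _ _)) τ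
      ⟨hτ.1, hτ.2.trans hT⟩).mono (Icc_subset_Icc_right hT)
  have hright : ∀ {Y : ℝ → Fin N → Plane} {v : Fin N → Plane} {τ : ℝ}, τ ∈ Ico 0 T₁ →
      HasDerivWithinAt Y v (Icc 0 T₁) τ → HasDerivWithinAt Y v (Ici τ) τ := by
    intro Y v τ hτ h
    refine h.mono_of_mem_nhdsWithin ?_
    exact mem_of_superset (Icc_mem_nhdsGE hτ.2) (Icc_subset_Icc_left hτ.1)
  exact ODE_solution_unique (v := fun _ => vortexField γ (radialKernel κ)) (fun _ => hΛ)
    (HasDerivWithinAt.continuousOn hm₁) (fun τ hτ => hright hτ (hm₁ τ (Ico_subset_Icc_self hτ)))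
    (HasDerivWithinAt.continuousOn hm₂) (fun τ hτ => hright hτ (hm₂ τ (Ico_subset_Icc_self hτ)))
    (h₁.initial.trans h₂.initial.symm)

lemma IsSeparatedSolution.contDiffOn {T δ L : ℝ} {x : Fin N → Plane} {Y : ℝ → Fin N → Plane}
    (hδ : 0 < δ) (hY : IsSeparatedSolution m c γ T δ L x Y) : ContDiffOn ℝ ∞ Y (Icc 0 T) := by
  obtain ⟨κ, hκ⟩ := exists_isCutoffProfile m c hδ
    (show δ < max L (δ + 1) from (lt_add_one δ).trans_le (le_max_right _ _))
  have hV : ContDiff ℝ ∞ (vortexField γ (radialKernel κ)) :=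
    contDiff_vortexField (contDiff_radialKernel hκ.contDiff)
  exact ODE.contDiffOn_enat_Icc_of_hasDerivWithinAt (n := ⊤) (u := univ)
    (f := fun _ => vortexField γ (radialKernel κ)) (hV.comp contDiff_snd).contDiffOn
    (hY.motion_cutoff hκ hδ le_rfl (le_max_left _ _)) (mapsTo_univ _ _)

/-- Separated solutions on arbitrarily long time intervals patch to a global solution. -/
lemma exists_isGlobalSmoothSolution {x : Fin N → Plane}
    (h : ∀ n : ℕ, ∃ Y δ L, 0 < δ ∧ IsSeparatedSolution m c γ (n + 1) δ L x Y) :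
    ∃ X, IsGlobalSmoothSolution (green m c) γ x X := by
  choose Y δ L hδ hY using h
  -- The n-th solution lives on [0, n + 1], so t < ⌊t⌋ + 1 leaves room to the right and X agrees
  -- with a single solution near t.
  set X : ℝ → Fin N → Plane := fun t => Y ⌊t⌋₊ t
  have hX : ∀ (n : ℕ) (t : ℝ), 0 ≤ t → t < n + 1 → X t = Y n t := by
    intro n t h0 ht
    have hn : ⌊t⌋₊ ≤ n := by
      have := (Nat.floor_lt h0).2 (show t < ((n + 1 : ℕ) : ℝ) by exact_mod_cast ht)
      omega
    refine (hY ⌊t⌋₊).eqOn (hδ _) (hδ _) (hY n) ?_ ⟨h0, (Nat.lt_floor_add_one t).le⟩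
    have : (⌊t⌋₊ : ℝ) ≤ n := by exact_mod_cast hn
    linarith
  have hmem : ∀ t : ℝ, 0 ≤ t → t ∈ Icc (0 : ℝ) (⌊t⌋₊ + 1) := fun t ht =>
    ⟨ht, (Nat.lt_floor_add_one t).le⟩
  have hnhds : ∀ t : ℝ, 0 ≤ t → Icc (0 : ℝ) (⌊t⌋₊ + 1) ∈ 𝓝[Ici 0] t := by
    intro t _
    filter_upwards [self_mem_nhdsWithin,
      mem_nhdsWithin_of_mem_nhds (Iio_mem_nhds (Nat.lt_floor_add_one t))] with s hs hs'
    exact ⟨hs, le_of_lt hs'⟩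
  have heq : ∀ t : ℝ, 0 ≤ t → X =ᶠ[𝓝[Ici 0] t] Y ⌊t⌋₊ := by
    intro t _
    filter_upwards [self_mem_nhdsWithin,
      mem_nhdsWithin_of_mem_nhds (Iio_mem_nhds (Nat.lt_floor_add_one t))] with s hs hs'
    exact hX _ s hs hs'
  have hder : ∀ t : ℝ, 0 ≤ t →
      HasDerivWithinAt X (vortexField γ (perpGrad (green m c)) (X t)) (Ici 0) t := by
    intro t ht
    exact (((hY ⌊t⌋₊).motion t (hmem t ht)).mono_of_mem_nhdsWithin
      (hnhds t ht)).congr_of_eventuallyEq (heq t ht) rfl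
  have hsmooth : ContDiffOn ℝ ∞ X (Ici 0) := by
    intro t ht
    exact (((hY ⌊t⌋₊).contDiffOn (hδ _) t (hmem t ht)).mono_of_mem_nhdsWithin
      (hnhds t ht)).congr_of_eventuallyEq (heq t ht) rfl
  refine ⟨fun j t => X t j, ?_, ?_, ?_, ?_⟩
  · intro j
    have : X 0 = x := (hY _).initial
    rw [this]
  · intro t ht j k hjk hcol
    have := ((hY ⌊t⌋₊).separated t (hmem t ht) j k hjk).1
    have h0 : Y ⌊t⌋₊ t j - Y ⌊t⌋₊ t k = 0 := sub_eq_zero.2 hcol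
    rw [h0, norm_zero] at this
    exact absurd (hδ ⌊t⌋₊) (not_lt.2 this)
  · intro j
    exact contDiffOn_pi.1 hsmooth j
  · intro j t ht
    exact hasDerivWithinAt_pi.1 (hder t ht) j

/-- Flow on `[0, T]` of a bounded Lipschitz field, started in a ball, jointly continuous. -/
lemma exists_flow {E : Type*} [NormedAddCommGroup E] [NormedSpace ℝ E] [CompleteSpace E]
    {V : E → E} {Λ : ℝ≥0} {M : ℝ} (hΛ : LipschitzWith Λ V) (hM : ∀ x, ‖V x‖ ≤ M) {R T : ℝ}
    (hR : 0 ≤ R) (hT : 0 ≤ T) :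
    ∃ α : E × ℝ → E, (∀ x ∈ Metric.closedBall (0 : E) R, α (x, 0) = x ∧
      ∀ t ∈ Icc 0 T, HasDerivWithinAt (fun t => α (x, t)) (V (α (x, t))) (Icc 0 T) t) ∧
      ContinuousOn α (Metric.closedBall 0 R ×ˢ Icc 0 T) := by
  have hM0 : 0 ≤ M := (norm_nonneg _).trans (hM 0)
  have hPL : IsPicardLindelof (fun _ : ℝ => V) (tmin := 0) (tmax := T) ⟨0, le_rfl, hT⟩ (0 : E)
      (R.toNNReal + M.toNNReal * T.toNNReal) R.toNNReal M.toNNReal Λ := by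
    refine IsPicardLindelof.of_time_independent (fun x _ => ?_) hΛ.lipschitzOnWith ?_
    · rw [Real.coe_toNNReal _ hM0]
      exact hM x
    · simp [hT, hM0, hR]
  obtain ⟨α, h1, h2⟩ := hPL.exists_forall_mem_closedBall_eq_hasDerivWithinAt_continuousOn
  rw [Real.coe_toNNReal _ hR] at h1 h2
  exact ⟨α, h1, h2⟩

/-! ### The averaged energy estimate and the conclusion -/

/-- Almost every configuration in a ball evolves without collision up to time `T`. -/
theorem measure_not_exists_isSeparatedSolution (hm₁ : 1 < m) (hm₂ : m < 2) (hc : 0 < c)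
    (hγ : ∀ J : Finset (Fin N), J.Nonempty → ∑ j ∈ J, γ j ≠ 0) {R T : ℝ} (hR : 0 < R)
    (hT : 0 < T) :
    volume ({x : Fin N → Plane | ¬ ∃ Y δ L, 0 < δ ∧ IsSeparatedSolution m c γ T δ L x Y} ∩
      Metric.ball 0 R) = 0 := by
  have hq : 0 < 3 - m := by linarith
  have hq2 : 3 - m < 2 := by linarith
  have h2m : 0 < 2 - m := by linarith
  -- Outside the unit ball every truncated kernel is bounded by c (2 - m), whatever ε, and the whole
  -- system has no external field. Hence D, R' and C below do not depend on ε.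
  obtain ⟨D, hD0, hD⟩ := exists_displacement_bound (E := Plane) γ hγ
    (b := c * (2 - m)) (by positivity) hT.le N 0 le_rfl
  set R' := R + D + 1
  have hR' : 0 < R' := by positivity
  set bad := {x : Fin N → Plane | ¬ ∃ Y δ L, 0 < δ ∧ IsSeparatedSolution m c γ T δ L x Y}
  set A := ENNReal.ofReal ((2 - m) * ((∑ l, |γ l|) * (c * (2 - m))))
  set C := (∫⁻ x in Metric.ball (0 : Fin N → Plane) R, lyapunovMajorant N (3 - m) x) +
    ENNReal.ofReal T * (A * ∫⁻ x in Metric.ball (0 : Fin N → Plane) R', rateMajorant N (3 - m) x)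
    with hC
  have hCtop : C ≠ ⊤ := by
    refine (ENNReal.add_lt_top.2 ⟨setLIntegral_lyapunovMajorant_lt_top hq hq2 hR, ?_⟩).ne
    exact ENNReal.mul_lt_top ENNReal.ofReal_lt_top (ENNReal.mul_lt_top ENNReal.ofReal_lt_top
      (setLIntegral_rateMajorant_lt_top hq hq2 hR'))
  have main : ∀ ε, 0 < ε → ε < 1 →
      ENNReal.ofReal ((2 * ε ^ 2) ^ ((m - 2) / 2)) * volume (bad ∩ Metric.ball 0 R) ≤ C := by
    intro ε hε hε1
    -- Within the ball of radius R' distances are below 2 R', so the outer cutoff is never felt.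
    obtain ⟨κ, hκ⟩ := exists_isCutoffProfile m c hε (show ε < 2 * R' by
      have : 1 ≤ R' := by simp only [R']; linarith
      linarith)
    have hKs := contDiff_radialKernel hκ.contDiff
    have hKc := hasCompactSupport_radialKernel hκ.hasCompactSupport
    set V := vortexField γ (radialKernel κ) with hVdef
    have hVs : ContDiff ℝ ∞ V := contDiff_vortexField hKs
    obtain ⟨Λ, hΛ⟩ := exists_lipschitzWith_vortexField (γ := γ) hKs hKc
    obtain ⟨M, hM⟩ := exists_norm_vortexField_le (γ := γ) hKs hKc
    have hdiv : ∀ x, LinearMap.trace ℝ (Fin N → Plane) (fderiv ℝ V x) = 0 :=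
      trace_fderiv_vortexField (hKs.differentiable (by simp))
        (trace_fderiv_radialKernel hκ.contDiff)
    obtain ⟨α, hα, hαc⟩ := exists_flow hΛ hM hR.le hT.le
    have hball : ∀ x ∈ Metric.ball (0 : Fin N → Plane) R, x ∈ Metric.closedBall 0 R :=
      fun x hx => Metric.ball_subset_closedBall hx
    have hstay : ∀ x ∈ Metric.ball (0 : Fin N → Plane) R, ∀ t ∈ Icc 0 T,
        α (x, t) ∈ Metric.ball 0 R' := by
      intro x hx t ht
      have hsol := hα x (hball x hx)
      rw [mem_ball_zero_iff, pi_norm_lt_iff hR']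
      intro j
      have hdisp := hD Finset.univ (by simp) (radialKernel κ) (radialKernel_neg κ)
        (fun u hu => by
          refine (norm_radialKernel_le hc hm₂ hκ.abs_le u).trans ?_
          exact mul_le_of_le_one_right (by positivity)
            (Real.rpow_le_one_of_one_le_of_nonpos hu (by linarith)))
        (fun j t => α (x, t) j) (fun j t => V (α (x, t)) j) 0 T (by linarith)
        (fun j _ τ hτ => hasDerivWithinAt_pi.1 (hsol.2 τ hτ) j)
        (fun j _ τ _ => by simp [hVdef, vortexField]) j (Finset.mem_univ j) t ht 0
        ⟨le_rfl, hT.le⟩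
      rw [hsol.1, dist_eq_norm] at hdisp
      have hxj : ‖x j‖ < R := (norm_le_pi_norm x j).trans_lt (mem_ball_zero_iff.1 hx)
      have := norm_le_norm_sub_add (α (x, t) j) (x j)
      simp only [R']
      linarith
    set w : (Fin N → Plane) → ℝ := fun x => lyapunovRate m ε x (V x)
    have hwc : Continuous w := continuous_lyapunovRate m hε hVs.continuous
    set F : (Fin N → Plane) → ℝ≥0∞ := fun x => ENNReal.ofReal (lyapunov m ε x) +
      ∫⁻ s in Icc 0 T, ENNReal.ofReal |w (α (x, s))| with hF
    have hαt : ∀ x ∈ Metric.ball (0 : Fin N → Plane) R,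
        ContinuousOn (fun t => α (x, t)) (Icc 0 T) := fun x hx =>
      HasDerivWithinAt.continuousOn (hα x (hball x hx)).2
    have hbad : ∀ x ∈ bad ∩ Metric.ball 0 R,
        ENNReal.ofReal ((2 * ε ^ 2) ^ ((m - 2) / 2)) ≤ F x := by
      rintro x ⟨hxbad, hx⟩
      -- If F is below the threshold, the energy stays below it on [0, T], so all distances exceed ε
      -- and the truncated trajectory is a true solution.
      by_contra! hlt
      refine hxbad ⟨fun t => α (x, t), ε, 2 * R', hε, ?_⟩
      have hsol := hα x (hball x hx)
      have hsep : ∀ τ ∈ Icc 0 T, ∀ i j, i ≠ j →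
          ‖α (x, τ) i - α (x, τ) j‖ ∈ Icc ε (2 * R') := by
        intro τ hτ i j hij
        have h1 := ofReal_le_add_lintegral_abs_deriv hτ
          (fun s hs => hasDerivWithinAt_lyapunov m hε (hsol.2 s hs))
          (hwc.comp_continuousOn (hαt x hx))
        rw [hsol.1] at h1
        have h2 := ENNReal.ofReal_lt_ofReal_iff_of_nonneg (show 0 ≤ lyapunov m ε (α (x, τ)) from
          Finset.sum_nonneg fun i _ => Finset.sum_nonneg fun j _ => by positivity)
          |>.1 (h1.trans_lt hlt)
        refine ⟨(lt_norm_of_lyapunov_lt hm₂ hε h2 hij).le, ?_⟩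
        have h3 := mem_ball_zero_iff.1 (hstay x hx τ hτ)
        have h4 := norm_le_pi_norm (α (x, τ)) i
        have h5 := norm_le_pi_norm (α (x, τ)) j
        have h6 := norm_sub_le (α (x, τ) i) (α (x, τ) j)
        linarith
      exact ⟨hsol.1, fun τ hτ => by
        rw [← hκ.vortexField_eq hε (hsep τ hτ)]
        exact hsol.2 τ hτ, hsep⟩
    have hmeas : AEMeasurable (Function.uncurry fun x s => ENNReal.ofReal |w (α (x, s))|)
        ((volume.restrict (Metric.ball (0 : Fin N → Plane) R)).prod
          (volume.restrict (Icc (0 : ℝ) T))) := by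
      rw [Measure.prod_restrict]
      refine ContinuousOn.aemeasurable ?_ (measurableSet_ball.prod measurableSet_Icc)
      exact ENNReal.continuous_ofReal.comp_continuousOn ((continuous_abs.comp hwc).comp_continuousOn
        (hαc.mono (prod_mono Metric.ball_subset_closedBall subset_rfl)))
    have hFmeas : AEMeasurable F (volume.restrict (Metric.ball (0 : Fin N → Plane) R)) :=
      (ENNReal.measurable_ofReal.comp (continuous_lyapunov m hε).measurable).aemeasurable.add
        hmeas.lintegral_prod_right'
    have hflow : ∀ s ∈ Icc 0 T,
        ∫⁻ x in Metric.ball (0 : Fin N → Plane) R, ENNReal.ofReal |w (α (x, s))| ≤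
          A * ∫⁻ x in Metric.ball (0 : Fin N → Plane) R', rateMajorant N (3 - m) x := by
      intro s hs
      -- Extending by zero outside an open ball keeps lower semicontinuity, as Liouville's
      -- inequality requires, and localizes the integral to the reachable region.
      set g : (Fin N → Plane) → ℝ≥0∞ :=
        (Metric.ball 0 R').indicator fun x => ENNReal.ofReal |w x| with hg
      have hglsc : LowerSemicontinuous g := by
        intro x y hy
        by_cases hx : x ∈ Metric.ball (0 : Fin N → Plane) R'
        · rw [hg, indicator_of_mem hx] at hy
          have hcont : Continuous fun x => ENNReal.ofReal |w x| :=
            ENNReal.continuous_ofReal.comp (continuous_abs.comp hwc)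
          filter_upwards [Metric.isOpen_ball.mem_nhds hx,
            hcont.continuousAt.eventually_const_lt hy] with z hz hz'
          rwa [hg, indicator_of_mem hz]
        · rw [hg, indicator_of_notMem hx] at hy
          exact absurd hy not_lt_zero
      calc ∫⁻ x in Metric.ball (0 : Fin N → Plane) R, ENNReal.ofReal |w (α (x, s))|
          = ∫⁻ x in Metric.ball (0 : Fin N → Plane) R, g (α (x, s)) :=
            setLIntegral_congr_fun measurableSet_ball fun x hx => by
              simp only [hg, indicator_of_mem (hstay x hx s hs)]
        _ ≤ ∫⁻ x, g x := lintegral_comp_flow_le (hVs.differentiable (by simp)) hΛ hM hdiv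
              measurableSet_ball hs.1 (X := fun x s => α (x, s))
              (fun x hx => (hα x (hball x hx)).1)
              (fun x hx τ hτ => ((hα x (hball x hx)).2 τ ⟨hτ.1, hτ.2.trans hs.2⟩).mono
                (Icc_subset_Icc_right hs.2)) hglsc
        _ = ∫⁻ x in Metric.ball (0 : Fin N → Plane) R', ENNReal.ofReal |w x| :=
            lintegral_indicator measurableSet_ball _
        _ ≤ ∫⁻ x in Metric.ball (0 : Fin N → Plane) R', A * rateMajorant N (3 - m) x :=
            lintegral_mono fun x => ofReal_abs_lyapunovRate_le hc hm₂ hκ.abs_le x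
        _ = _ := lintegral_const_mul' _ _ ENNReal.ofReal_ne_top
    have hFint : ∫⁻ x in Metric.ball (0 : Fin N → Plane) R, F x ≤ C := by
      have hHm : Measurable fun x : Fin N → Plane => ENNReal.ofReal (lyapunov m ε x) :=
        ENNReal.measurable_ofReal.comp (continuous_lyapunov m hε).measurable
      rw [hF, lintegral_add_left hHm, hC]
      refine add_le_add (lintegral_mono fun x => ofReal_lyapunov_le hm₂ ε x) ?_
      rw [lintegral_lintegral_swap hmeas]
      refine (setLIntegral_mono' measurableSet_Icc hflow).trans_eq ?_
      rw [setLIntegral_const, Real.volume_Icc, sub_zero, mul_comm]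
    refine le_trans ?_ ((mul_meas_ge_le_lintegral₀ hFmeas
      (ENNReal.ofReal ((2 * ε ^ 2) ^ ((m - 2) / 2)))).trans hFint)
    refine mul_le_mul_right ?_ _
    rw [Measure.restrict_apply' measurableSet_ball]
    exact measure_mono fun x hx => ⟨hbad x hx, hx.2⟩
  have hlarge : ∀ n : ℕ, (n : ℝ≥0∞) * volume (bad ∩ Metric.ball 0 R) ≤ C := by
    intro n
    have hn2 : (1 : ℝ) < n + 2 := by
      have : (0 : ℝ) ≤ n := Nat.cast_nonneg n
      linarith
    -- Here s plays the role of 2ε², chosen so that the threshold s^((m-2)/2) equals n + 2.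
    set s : ℝ := ((n : ℝ) + 2) ^ (2 / (m - 2)) with hs
    have hs0 : 0 < s := Real.rpow_pos_of_pos (by linarith) _
    have hs1 : s < 1 := Real.rpow_lt_one_of_one_lt_of_neg hn2
      (div_neg_of_pos_of_neg two_pos (by linarith))
    have hsq : 2 * Real.sqrt (s / 2) ^ 2 = s := by
      rw [Real.sq_sqrt (by positivity)]
      ring
    have h1 := main (Real.sqrt (s / 2)) (Real.sqrt_pos.2 (by positivity))
      ((Real.sqrt_lt' one_pos).2 (by linarith))
    rw [hsq, hs, ← Real.rpow_mul (by linarith)] at h1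
    have he : 2 / (m - 2) * ((m - 2) / 2) = 1 := by
      have : m - 2 ≠ 0 := by linarith
      field_simp
    rw [he, Real.rpow_one] at h1
    refine le_trans ?_ h1
    gcongr
    rw [← ENNReal.ofReal_natCast]
    exact ENNReal.ofReal_le_ofReal (by linarith)
  by_contra hne
  obtain ⟨n, hn⟩ := ENNReal.exists_nat_gt (ENNReal.div_ne_top hCtop hne)
  rw [ENNReal.div_lt_iff (Or.inl hne) (Or.inr hCtop)] at hn
  exact absurd hn (not_lt.2 (hlarge n))

end PointVortex

theorem theoremt (N : ℕ) (m c : ℝ) (hm₁ : 1 < m) (hm₂ : m < 2) (hc : 0 < c)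
    (γ : Fin N → ℝ)
    (hγ : ∀ J : Finset (Fin N), J.Nonempty → ∑ j ∈ J, γ j ≠ 0) :
    ∀ᵐ x : Fin N → PointVortex.Plane ∂MeasureTheory.volume,
      ∃ X : Fin N → ℝ → PointVortex.Plane,
        PointVortex.IsGlobalSmoothSolution (PointVortex.green m c) γ x X := by
  have h : ∀ᵐ x : Fin N → PointVortex.Plane ∂MeasureTheory.volume, ∀ R n : ℕ,
      ¬ (x ∈ {x | ¬ ∃ Y δ L, 0 < δ ∧
        PointVortex.IsSeparatedSolution m c γ (n + 1) δ L x Y} ∩ Metric.ball 0 ((R : ℝ) + 1)) := by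
    refine MeasureTheory.ae_all_iff.2 fun R => MeasureTheory.ae_all_iff.2 fun n => ?_
    rw [← MeasureTheory.measure_eq_zero_iff_ae_notMem]
    exact PointVortex.measure_not_exists_isSeparatedSolution hm₁ hm₂ hc hγ (by positivity)
      (by positivity)
  filter_upwards [h] with x hx
  refine PointVortex.exists_isGlobalSmoothSolution fun n => ?_
  obtain ⟨R, hR⟩ := exists_nat_gt ‖x‖
  by_contra hcon
  exact hx R n ⟨hcon, by rw [mem_ball_zero_iff]; linarith⟩
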